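/- **Setting.** Let $S$ be a unital inverse semigroup with unit $e$, and write $s^*$ for the inverse of $s$. A *Busby–Smith twisted action* $(\alpha,u)$ of $S$ on a $C^*$-algebra $A$ consists of closed two-sided ideals $A_s$ of $A$, $*$-isomorphisms $\alpha_s:A_{s^*}\to A_s$ and unitary multipliers $u_{s,t}\in M(A_{st})$ ($s,t\in S$) such that, for all $r,s,t\in S$, (a) $A_e=A$; (b) $\alpha_s\alpha_t=\mathrm{Ad}\,u_{s,t}\circ\alpha_{st}$ as partially defined maps (with equal domains); (c) $u_{s,t}=1$ if $s$ or $t$ is idempotent; (d) $\alpha_r(a u_{s,t})u_{r,st}=\alpha_r(a)u_{r,s}u_{rs,t}$ for $a\in A_{r^*}A_{st}$. A *covariant representation* $(\pi,V,H)$ of $(A,S,\alpha,u)$ consists of a nondegenerate representation $\pi$ of $A$ on a Hilbert space $H$ and partial isometries $V_s$ on $H$ ($s\in S$) such that, for all $r,s\in S$: $V_s$ has initial space $\pi(A_{s^*})H$ and final space $\pi(A_s)H$; $V_rV_s=\pi(u_{r,s})V_{rs}$, where $\pi(u_{r,s})$ is given by the canonical extension of $\pi|_{A_{rs}}$ to $M(A_{rs})$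 (zero on $(\pi(A_{rs})H)^\perp$); and $\pi(\alpha_s(a))=V_s\pi(a)V_s^*$ for $a\in A_{s^*}$. Let $(\alpha,u)$ and $(\beta,v)$ be Busby–Smith twisted actions of $S$ on $C^*$-algebras $A$ and $B$. We write $(A,S,\alpha,u)\sim_{X,\phi}(B,S,\beta,v)$ if $X$ is an $A$–$B$ imprimitivity bimodule with $A_s\cdot X=X\cdot B_s=:X_s$ for all $s$, and $\phi_s:X_{s^*}\to X_s$ are maps such that each $(\alpha_s,\phi_s,\beta_s)$ is an isomorphism of the imprimitivity subbimodule ${}_{A_{s^*}}(X_{s^*})_{B_{s^*}}$ onto ${}_{A_s}(X_s)_{B_s}$ (i.e. $\phi_s$ is surjective and compatible with both module actions and both inner products), and $\phi_s\phi_t=u_{s,t}\cdot\phi_{st}(\cdot)\cdot v_{s,t}^*$ for all $s,t\in S$ as partially defined maps (with equal domains). For a representation $\pi$ of $B$ on $H$, let $X\otimes_BH$ be the Hausdorff completion of the algebraic tensor product $X\odot H$ for the semi-inner product (linear in the first variable) determined by $(x\otimes\xi\mid y\otimes\eta)=(\pi(\langle y,x\rangle_B)\xi\mid\eta)$, and let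 $X_s\otimes_BH$ be its closed subspace spanned by the $x\otimes\xi$ with $x\in X_s$, $\xi\in H$. **Theorem.** Suppose $(A,S,\alpha,u)\sim_{X,\phi}(B,S,\beta,v)$ and let $(\pi,V,H)$ be a covariant representation of $(\beta,v)$. Then there is a unique covariant representation $(\pi^X,V^X,X\otimes_BH)$ of $(\alpha,u)$ such that $$\pi^X(a)(x\otimes\xi)=(a\cdot x)\otimes\xi\qquad(a\in A,\ x\in X,\ \xi\in H),$$ $$V^X_s(x\otimes\xi)=\phi_s(x)\otimes V_s\xi\qquad(s\in S,\ x\in X_{s^*},\ \xi\in H),$$ and $V^X_s$ is zero on the orthogonal complement of $X_{s^*}\otimes_BH$ for every $s\in S$. -/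

import Mathlib

open scoped TensorProduct Topology ComplexConjugate
open Filter

noncomputable section

/-- A unital inverse semigroup: every `s` has a unique generalized inverse, written `s⁻¹`
(the element often denoted `s*`). -/
class InverseMonoid (S : Type*) extends Monoid S, Inv S where
  mul_inv_mul : ∀ s : S, s * s⁻¹ * s = s
  inv_mul_inv : ∀ s : S, s⁻¹ * s * s⁻¹ = s⁻¹
  inv_unique : ∀ s t : S, s * t * s = s → t * s * t = t → t = s⁻¹

/-- A closed two-sided ideal of a C⋆-algebra. (Such ideals are automatically self-adjoint.) -/
structure ClosedIdeal (A : Type*) [NonUnitalCStarAlgebra A] extends NonUnitalStarSubalgebra ℂ A where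
  isClosed' : IsClosed carrier
  mul_mem_left' : ∀ (a : A) {x : A}, x ∈ carrier → a * x ∈ carrier
  mul_mem_right' : ∀ (a : A) {x : A}, x ∈ carrier → x * a ∈ carrier

namespace ClosedIdeal

variable {A : Type*} [NonUnitalCStarAlgebra A]

instance : SetLike (ClosedIdeal A) A where
  coe I := I.carrier
  coe_injective := by
    rintro ⟨I, _, _, _⟩ ⟨J, _, _, _⟩ h
    have : I = J := SetLike.coe_injective h
    subst this
    rfl

instance : NonUnitalSubringClass (ClosedIdeal A) A where
  add_mem {I} _ _ ha hb := I.add_mem' ha hb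
  zero_mem I := I.zero_mem'
  neg_mem {I} _ ha := neg_mem (s := I.toNonUnitalStarSubalgebra) ha
  mul_mem {I} _ _ ha hb := I.mul_mem' ha hb

instance : SMulMemClass (ClosedIdeal A) ℂ A where
  smul_mem {I} c _ ha := SMulMemClass.smul_mem (s := I.toNonUnitalStarSubalgebra) c ha

instance : StarMemClass (ClosedIdeal A) A where
  star_mem {I} _ ha := star_mem (s := I.toNonUnitalStarSubalgebra) ha

instance (I : ClosedIdeal A) : IsClosed (I : Set A) := I.isClosed'

end ClosedIdeal

open Classical in
/-- The extension of a partially defined map `f : I → J` (with `I ⊆ M`, `J ⊆ N`) by `0` outside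
its domain. It is only a device for composing partially defined maps: below it is always
evaluated inside the domain, or the domain is spelled out. -/
def partialApply {σ τ M N : Type*} [SetLike σ M] [SetLike τ N] [Zero N] {I : σ} {J : τ}
    (f : I → J) (x : M) : N :=
  if h : x ∈ I then (f ⟨x, h⟩ : N) else 0

/-- Left multiplication `b ↦ m b` of elements of an ideal `I` by a multiplier `m` of `I`. -/
def multL {A : Type*} [NonUnitalCStarAlgebra A] {I : ClosedIdeal A} (m : DoubleCentralizer ℂ I) :
    A → A :=
  partialApply (I := I) (J := I) fun b => m.fst b

/-- Right multiplication `b ↦ b m` of elements of an ideal `I` by a multiplier `m` of `I`. -/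
def multR {A : Type*} [NonUnitalCStarAlgebra A] {I : ClosedIdeal A} (m : DoubleCentralizer ℂ I) :
    A → A :=
  partialApply (I := I) (J := I) fun b => m.snd b

/-- A Busby-Smith twisted action `(β, v)` of a unital inverse semigroup `S` on a C⋆-algebra `A`:
closed ideals `A_s`, isomorphisms `β_s : A_{s*} → A_s` and unitary multipliers `v_{s,t}` of
`A_{st}`. -/
structure BusbySmithAction (S A : Type*) [InverseMonoid S] [NonUnitalCStarAlgebra A] where
  ideal : S → ClosedIdeal A
  act : ∀ s : S, ideal s⁻¹ ≃⋆ₐ[ℂ] ideal s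
  twist : ∀ s t : S, unitary (DoubleCentralizer ℂ (ideal (s * t)))
  /-- `A_e = A`. -/
  ideal_one : ∀ a : A, a ∈ ideal 1
  /-- `β_s β_t` and `Ad v_{s,t} ∘ β_{st}` have the same domain. -/
  act_act_domain : ∀ (s t : S) (a : A),
    (a ∈ ideal t⁻¹ ∧ partialApply (act t) a ∈ ideal s⁻¹) ↔ a ∈ ideal (s * t)⁻¹
  /-- `β_s (β_t a) = v_{s,t} β_{st}(a) v_{s,t}*`. -/
  act_act : ∀ (s t : S), ∀ a ∈ ideal (s * t)⁻¹,
    partialApply (act s) (partialApply (act t) a) =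
      multR (star (twist s t : DoubleCentralizer ℂ (ideal (s * t))))
        (multL (twist s t : DoubleCentralizer ℂ (ideal (s * t))) (partialApply (act (s * t)) a))
  /-- `v_{s,t} = 1` if `s` or `t` is idempotent. -/
  twist_eq_one : ∀ s t : S, (IsIdempotentElem s ∨ IsIdempotentElem t) → twist s t = 1
  /-- The cocycle identity `β_r(a v_{s,t}) v_{r,st} = β_r(a) v_{r,s} v_{rs,t}` for
  `a ∈ A_{r*} A_{st} = A_{r*} ∩ A_{st}`. -/
  cocycle : ∀ (r s t : S) (a : A), a ∈ ideal r⁻¹ → a ∈ ideal (s * t) →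
    multR (twist r (s * t) : DoubleCentralizer ℂ (ideal (r * (s * t))))
        (partialApply (act r) (multR (twist s t : DoubleCentralizer ℂ (ideal (s * t))) a)) =
      multR (twist (r * s) t : DoubleCentralizer ℂ (ideal (r * s * t)))
        (multR (twist r s : DoubleCentralizer ℂ (ideal (r * s))) (partialApply (act r) a))

/-! ### Covariant representations -/

section Representations

variable {A H : Type*} [NonUnitalCStarAlgebra A] [NormedAddCommGroup H] [InnerProductSpace ℂ H]
  [CompleteSpace H]

/-- `V` is a partial isometry. -/
def IsPartialIsometry (V : H →L[ℂ] H) : Prop := V * star V * V = V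

/-- The initial space of a partial isometry, the orthogonal complement of its kernel. -/
def initialSpace (V : H →L[ℂ] H) : Submodule ℂ H := V.kerᗮ

/-- The final space of a partial isometry, its range. -/
def finalSpace (V : H →L[ℂ] H) : Submodule ℂ H := V.range

/-- The closed subspace `π(I)H` of `H`. -/
def essSpace (π : A →⋆ₙₐ[ℂ] (H →L[ℂ] H)) (I : ClosedIdeal A) : Submodule ℂ H :=
  (Submodule.span ℂ {η : H | ∃ a ∈ I, ∃ ξ : H, η = π a ξ}).topologicalClosure

/-- `π` is nondegenerate: the vectors `π(a)ξ` span a dense subspace. -/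
def IsNondegenerateRep (π : A →⋆ₙₐ[ℂ] (H →L[ℂ] H)) : Prop :=
  (Submodule.span ℂ {η : H | ∃ (a : A) (ξ : H), η = π a ξ}).topologicalClosure = ⊤

/-- `T = π(m)`, the value at the multiplier `m` of `I` of the canonical extension of `π|_I` to
multipliers: `π(m) π(a) ξ = π(m a) ξ` for `a ∈ I`, and `π(m)` vanishes on the orthogonal
complement of `π(I)H`. These two conditions determine `T`. -/
def IsMultiplierImage (π : A →⋆ₙₐ[ℂ] (H →L[ℂ] H)) {I : ClosedIdeal A}
    (m : DoubleCentralizer ℂ I) (T : H →L[ℂ] H) : Prop :=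
  (∀ a ∈ I, ∀ ξ : H, T (π a ξ) = π (multL m a) ξ) ∧ ∀ η ∈ (essSpace π I)ᗮ, T η = 0

/-- A covariant representation `(π, V)` of a Busby-Smith twisted action on the Hilbert
space `H`. -/
structure CovariantRep {S : Type*} [InverseMonoid S] (β : BusbySmithAction S A) (H : Type*)
    [NormedAddCommGroup H] [InnerProductSpace ℂ H] [CompleteSpace H] where
  π : A →⋆ₙₐ[ℂ] (H →L[ℂ] H)
  V : S → H →L[ℂ] H
  nondegenerate : IsNondegenerateRep π
  isPartialIsometry : ∀ s, IsPartialIsometry (V s)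
  initialSpace_eq : ∀ s, initialSpace (V s) = essSpace π (β.ideal s⁻¹)
  finalSpace_eq : ∀ s, finalSpace (V s) = essSpace π (β.ideal s)
  /-- `V_r V_s = π(v_{r,s}) V_{rs}`. -/
  mul_eq : ∀ r s, ∃ T : H →L[ℂ] H,
    IsMultiplierImage π (β.twist r s : DoubleCentralizer ℂ (β.ideal (r * s))) T ∧
      V r * V s = T * V (r * s)
  /-- `π(β_s(a)) = V_s π(a) V_s*` for `a ∈ A_{s*}`. -/
  covariant : ∀ (s : S) (a : β.ideal s⁻¹), π (β.act s a : A) = V s * π (a : A) * star (V s)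

end Representations

/-! ### Hilbert bimodules -/

/-- Completeness of an additive group for the (semi)norm `q`. -/
def IsCompleteFor {X : Type*} [AddCommGroup X] (q : X → ℝ) : Prop :=
  ∀ u : ℕ → X, (∀ ε > 0, ∃ N, ∀ m ≥ N, ∀ n ≥ N, q (u m - u n) < ε) →
    ∃ x, Tendsto (fun n => q (u n - x)) atTop (𝓝 0)

/-- A Hilbert `A`-`B`-bimodule structure on the complex vector space `X`: commuting left and right
actions `a · x = lact a x` and `x · b = ract x b`, with an `A`-valued inner product `linner`
(linear in the first variable) and a `B`-valued inner product `rinner` (linear in the second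
variable) for which `X` is a left Hilbert `A`-module and a right Hilbert `B`-module. -/
structure HilbertBimodule (A B X : Type*)
    [NonUnitalCStarAlgebra A] [PartialOrder A] [StarOrderedRing A]
    [NonUnitalCStarAlgebra B] [PartialOrder B] [StarOrderedRing B]
    [AddCommGroup X] [Module ℂ X] where
  lact : A →ₗ[ℂ] X →ₗ[ℂ] X
  ract : X →ₗ[ℂ] B →ₗ[ℂ] X
  lact_mul : ∀ a a' x, lact (a * a') x = lact a (lact a' x)
  ract_mul : ∀ x b b', ract x (b * b') = ract (ract x b) b'
  lact_ract : ∀ a x b, lact a (ract x b) = ract (lact a x) b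
  linner : X → X → A
  linner_linear : ∀ (c d : ℂ) x y z, linner (c • x + d • y) z = c • linner x z + d • linner y z
  linner_lact : ∀ a x y, linner (lact a x) y = a * linner x y
  star_linner : ∀ x y, star (linner x y) = linner y x
  linner_self_nonneg : ∀ x, 0 ≤ linner x x
  linner_definite : ∀ x, linner x x = 0 → x = 0
  rinner : X → X → B
  rinner_linear : ∀ (c d : ℂ) x y z, rinner x (c • y + d • z) = c • rinner x y + d • rinner x z
  rinner_ract : ∀ x y b, rinner x (ract y b) = rinner x y * b
  star_rinner : ∀ x y, star (rinner x y) = rinner y x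
  rinner_self_nonneg : ∀ x, 0 ≤ rinner x x
  rinner_definite : ∀ x, rinner x x = 0 → x = 0
  linner_lact_eq : ∀ x y z, lact (linner x y) z = ract x (rinner y z)
  complete_left : IsCompleteFor fun x => √‖linner x x‖
  complete_right : IsCompleteFor fun x => √‖rinner x x‖

namespace HilbertBimodule

variable {A B X : Type*}
  [NonUnitalCStarAlgebra A] [PartialOrder A] [StarOrderedRing A]
  [NonUnitalCStarAlgebra B] [PartialOrder B] [StarOrderedRing B]
  [AddCommGroup X] [Module ℂ X] (E : HilbertBimodule A B X)

/-- An imprimitivity bimodule is a Hilbert bimodule that is full on both sides. -/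
def IsImprimitivity : Prop :=
  closure (Submodule.span ℂ {a : A | ∃ x y, a = E.linner x y} : Set A) = Set.univ ∧
  closure (Submodule.span ℂ {b : B | ∃ x y, b = E.rinner x y} : Set B) = Set.univ

/-- `_I Y_J` is an imprimitivity subbimodule of `X`: `Y` is a closed subbimodule, and `I` and `J`
are the closed spans of the inner products of elements of `Y`. -/
structure IsImprimitivitySub (I : ClosedIdeal A) (Y : Submodule ℂ X) (J : ClosedIdeal B) :
    Prop where
  lact_mem : ∀ a, ∀ y ∈ Y, E.lact a y ∈ Y
  ract_mem : ∀ b, ∀ y ∈ Y, E.ract y b ∈ Y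
  closed : ∀ (u : ℕ → X) (x : X), (∀ n, u n ∈ Y) →
    Tendsto (fun n => √‖E.rinner (u n - x) (u n - x)‖) atTop (𝓝 0) → x ∈ Y
  left_eq : (I : Set A) =
    closure (Submodule.span ℂ {a : A | ∃ x ∈ Y, ∃ y ∈ Y, a = E.linner x y} : Set A)
  right_eq : (J : Set B) =
    closure (Submodule.span ℂ {b : B | ∃ x ∈ Y, ∃ y ∈ Y, b = E.rinner x y} : Set B)

/-- `(θ, φ, ψ)` is a partial automorphism of `X`: an isomorphism between imprimitivity
subbimodules `_I Y_J` and `_I' Y'_J'`. -/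
structure IsPartialAut {I I' : ClosedIdeal A} {Y Y' : Submodule ℂ X} {J J' : ClosedIdeal B}
    (θ : I ≃⋆ₐ[ℂ] I') (φ : Y → Y') (ψ : J ≃⋆ₐ[ℂ] J') : Prop where
  dom : E.IsImprimitivitySub I Y J
  cod : E.IsImprimitivitySub I' Y' J'
  map_ract : ∀ (x : Y) (b : J) (h : E.ract x b ∈ Y),
    (φ ⟨E.ract x b, h⟩ : X) = E.ract (φ x) (ψ b : B)
  map_rinner : ∀ (x y : Y) (h : E.rinner x y ∈ J),
    (ψ ⟨E.rinner x y, h⟩ : B) = E.rinner (φ x) (φ y)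
  map_lact : ∀ (a : I) (x : Y) (h : E.lact a x ∈ Y),
    (φ ⟨E.lact a x, h⟩ : X) = E.lact (θ a : A) (φ x)
  map_linner : ∀ (x y : Y) (h : E.linner x y ∈ I),
    (θ ⟨E.linner x y, h⟩ : A) = E.linner (φ x) (φ y)
  surjective : Function.Surjective φ

open Classical in
/-- The left action `y ↦ m · y` on `I · X` of a multiplier `m` of the ideal `I` of `A`, given by
`m · (a · x) = (m a) · x` for `a ∈ I`; it is well defined by `lmult_lact`. (Outside `I · X` the
value is `0`.) -/
def lmult {I : ClosedIdeal A} (m : DoubleCentralizer ℂ I) (y : X) : X :=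
  if h : ∃ p : I × X, y = E.lact (p.1 : A) p.2 then E.lact (m.fst h.choose.1 : A) h.choose.2 else 0

open Classical in
/-- The right action `y ↦ y · m` on `X · J` of a multiplier `m` of the ideal `J` of `B`, given by
`(x · b) · m = x · (b m)` for `b ∈ J`; it is well defined by `rmult_ract`. (Outside `X · J` the
value is `0`.) -/
def rmult {J : ClosedIdeal B} (m : DoubleCentralizer ℂ J) (y : X) : X :=
  if h : ∃ p : X × J, y = E.ract p.1 (p.2 : B) then E.ract h.choose.1 (m.snd h.choose.2 : B) else 0

lemma linner_add_left (x y z : X) : E.linner (x + y) z = E.linner x z + E.linner y z := by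
  simpa using E.linner_linear 1 1 x y z

lemma linner_sub_left (x y z : X) : E.linner (x - y) z = E.linner x z - E.linner y z := by
  simpa [sub_eq_add_neg] using E.linner_linear 1 (-1) x y z

lemma rinner_add_right (x y z : X) : E.rinner x (y + z) = E.rinner x y + E.rinner x z := by
  simpa using E.rinner_linear 1 1 x y z

lemma rinner_sub_right (x y z : X) : E.rinner x (y - z) = E.rinner x y - E.rinner x z := by
  simpa [sub_eq_add_neg] using E.rinner_linear 1 (-1) x y z

lemma rinner_zero_right (x : X) : E.rinner x 0 = 0 := by
  simpa using E.rinner_linear 0 0 x 0 0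

lemma rinner_smul_right (c : ℂ) (x y : X) : E.rinner x (c • y) = c • E.rinner x y := by
  simpa using E.rinner_linear c 0 x y 0

lemma rinner_add_left (x y z : X) : E.rinner (x + y) z = E.rinner x z + E.rinner y z := by
  rw [← E.star_rinner, E.rinner_add_right, star_add, E.star_rinner, E.star_rinner]

lemma rinner_smul_left (c : ℂ) (x y : X) : E.rinner (c • x) y = star c • E.rinner x y := by
  rw [← E.star_rinner, E.rinner_smul_right, star_smul, E.star_rinner]

lemma rinner_ract_left (x y : X) (b : B) : E.rinner (E.ract x b) y = star b * E.rinner x y := by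
  rw [← E.star_rinner, E.rinner_ract, star_mul, E.star_rinner]

lemma lmult_lact {I : ClosedIdeal A} (m : DoubleCentralizer ℂ I) (a : I) (x : X) :
    E.lmult m (E.lact (a : A) x) = E.lact (m.fst a : A) x := by
  have key : ∀ (a a' : I) (x x' : X), E.lact (a : A) x = E.lact (a' : A) x' →
      E.lact (m.fst a : A) x = E.lact (m.fst a' : A) x' := by
    intro a a' x x' h
    set z := E.lact (m.fst a : A) x - E.lact (m.fst a' : A) x' with hz
    have h1 : ∀ b : I, E.lact (b : A) z = 0 := by
      intro b
      have c1 : (b : A) * (m.fst a : A) = (m.snd b : A) * (a : A) :=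
        (congrArg Subtype.val (m.central b a)).symm
      have c2 : (b : A) * (m.fst a' : A) = (m.snd b : A) * (a' : A) :=
        (congrArg Subtype.val (m.central b a')).symm
      rw [hz, map_sub, ← E.lact_mul, ← E.lact_mul, c1, c2, E.lact_mul, E.lact_mul, h, sub_self]
    have h2 : E.linner z z ∈ I := by
      have : E.linner z z = (m.fst a : A) * E.linner x z - (m.fst a' : A) * E.linner x' z := by
        conv_lhs => rw [hz]
        rw [E.linner_sub_left, E.linner_lact, E.linner_lact]
      rw [this]
      exact sub_mem (I.mul_mem_right' _ (m.fst a).2) (I.mul_mem_right' _ (m.fst a').2)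
    have h3 : E.linner z z * E.linner z z = 0 := by
      rw [← E.linner_lact, h1 ⟨_, h2⟩]
      simpa using E.linner_linear 0 0 0 0 z
    have h4 : E.linner z z = 0 := by
      have h3' : star (E.linner z z) * E.linner z z = 0 := by rw [E.star_linner, h3]
      exact CStarRing.star_mul_self_eq_zero_iff _ |>.1 h3'
    exact sub_eq_zero.1 (E.linner_definite z h4)
  have h : ∃ p : I × X, E.lact (a : A) x = E.lact (p.1 : A) p.2 := ⟨(a, x), rfl⟩
  rw [lmult, dif_pos h]
  exact (key _ _ _ _ h.choose_spec).symm

lemma rmult_ract {J : ClosedIdeal B} (m : DoubleCentralizer ℂ J) (x : X) (b : J) :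
    E.rmult m (E.ract x (b : B)) = E.ract x (m.snd b : B) := by
  have key : ∀ (b b' : J) (x x' : X), E.ract x (b : B) = E.ract x' (b' : B) →
      E.ract x (m.snd b : B) = E.ract x' (m.snd b' : B) := by
    intro b b' x x' h
    set z := E.ract x (m.snd b : B) - E.ract x' (m.snd b' : B) with hz
    have h1 : ∀ c : J, E.ract z (c : B) = 0 := by
      intro c
      have c1 : (m.snd b : B) * (c : B) = (b : B) * (m.fst c : B) :=
        congrArg Subtype.val (m.central b c)
      have c2 : (m.snd b' : B) * (c : B) = (b' : B) * (m.fst c : B) :=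
        congrArg Subtype.val (m.central b' c)
      rw [hz, map_sub, LinearMap.sub_apply, ← E.ract_mul, ← E.ract_mul, c1, c2, E.ract_mul,
        E.ract_mul, h, sub_self]
    have h2 : E.rinner z z ∈ J := by
      have : E.rinner z z = E.rinner z x * (m.snd b : B) - E.rinner z x' * (m.snd b' : B) := by
        conv_lhs => rw [hz]
        rw [E.rinner_sub_right, E.rinner_ract, E.rinner_ract]
      rw [this]
      exact sub_mem (J.mul_mem_left' _ (m.snd b).2) (J.mul_mem_left' _ (m.snd b').2)
    have h3 : E.rinner z z * E.rinner z z = 0 := by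
      rw [← E.rinner_ract, h1 ⟨_, h2⟩, E.rinner_zero_right]
    have h4 : E.rinner z z = 0 := by
      have h3' : star (E.rinner z z) * E.rinner z z = 0 := by rw [E.star_rinner, h3]
      exact CStarRing.star_mul_self_eq_zero_iff _ |>.1 h3'
    exact sub_eq_zero.1 (E.rinner_definite z h4)
  have h : ∃ p : X × J, E.ract x (b : B) = E.ract p.1 (p.2 : B) := ⟨(x, b), rfl⟩
  rw [rmult, dif_pos h]
  exact (key _ _ _ _ h.choose_spec).symm

end HilbertBimodule

/-- A Morita equivalence `(X, φ)` between the Busby-Smith twisted actions `(A, S, α, u)` and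
`(B, S, β, v)`. -/
structure TwistedMoritaEquivalence {S A B : Type*} [InverseMonoid S]
    [NonUnitalCStarAlgebra A] [PartialOrder A] [StarOrderedRing A]
    [NonUnitalCStarAlgebra B] [PartialOrder B] [StarOrderedRing B]
    (X : Type*) [AddCommGroup X] [Module ℂ X]
    (α : BusbySmithAction S A) (β : BusbySmithAction S B) where
  bimod : HilbertBimodule A B X
  imprimitivity : bimod.IsImprimitivity
  /-- The subspaces `X_s`. -/
  sub : S → Submodule ℂ X
  /-- `X_s = A_s · X`. -/
  mem_sub_left : ∀ s x, x ∈ sub s ↔ ∃ a ∈ α.ideal s, ∃ y, x = bimod.lact a y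
  /-- `X_s = X · B_s`. -/
  mem_sub_right : ∀ s x, x ∈ sub s ↔ ∃ b ∈ β.ideal s, ∃ y, x = bimod.ract y b
  φ : ∀ s, sub s⁻¹ → sub s
  isPartialAut : ∀ s, bimod.IsPartialAut (α.act s) (φ s) (β.act s)
  /-- `φ_s φ_t` and `φ_{st}` have the same domain. -/
  φ_φ_domain : ∀ (s t : S) (x : X),
    (x ∈ sub t⁻¹ ∧ partialApply (φ t) x ∈ sub s⁻¹) ↔ x ∈ sub (s * t)⁻¹
  /-- `φ_s (φ_t x) = u_{s,t} · φ_{st}(x) · v_{s,t}*`. -/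
  φ_φ : ∀ (s t : S), ∀ x ∈ sub (s * t)⁻¹,
    partialApply (φ s) (partialApply (φ t) x) =
      bimod.rmult (star (β.twist s t : DoubleCentralizer ℂ (β.ideal (s * t))))
        (bimod.lmult (α.twist s t : DoubleCentralizer ℂ (α.ideal (s * t)))
          (partialApply (φ (s * t)) x))

/-! ### The induced Hilbert space -/

namespace HilbertBimodule

variable {A B X H : Type*}
  [NonUnitalCStarAlgebra A] [PartialOrder A] [StarOrderedRing A]
  [NonUnitalCStarAlgebra B] [PartialOrder B] [StarOrderedRing B]
  [AddCommGroup X] [Module ℂ X] [NormedAddCommGroup H] [InnerProductSpace ℂ H] [CompleteSpace H]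

/-- The sesquilinear form on `X ⊙ H` determined by
`⟪x ⊗ ξ, y ⊗ η⟫ = ⟪ξ, π(⟨x, y⟩_B) η⟫` (conjugate linear in the first variable). -/
def preForm (E : HilbertBimodule A B X) (π : B →⋆ₙₐ[ℂ] (H →L[ℂ] H)) :
    (X ⊗[ℂ] H) →ₗ⋆[ℂ] (X ⊗[ℂ] H) →ₗ[ℂ] ℂ :=
  TensorProduct.lift <|
    LinearMap.mk₂'ₛₗ (starRingEnd ℂ) (starRingEnd ℂ)
      (fun (x : X) (ξ : H) => TensorProduct.lift <|
        LinearMap.mk₂ ℂ (fun (y : X) (η : H) => inner ℂ ξ (π (E.rinner x y) η))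
          (by intros; simp [rinner_add_right])
          (by intros; simp [rinner_smul_right])
          (by intros; simp)
          (by intros; simp))
      (by intros; ext; simp [rinner_add_left])
      (by intros; ext; simp [rinner_smul_left])
      (by intros; ext; simp)
      (by intros; ext; simp [mul_comm])

lemma preForm_tmul (E : HilbertBimodule A B X) (π : B →⋆ₙₐ[ℂ] (H →L[ℂ] H)) (x y : X) (ξ η : H) :
    E.preForm π (x ⊗ₜ ξ) (y ⊗ₜ η) = inner ℂ ξ (π (E.rinner x y) η) := rfl

lemma preForm_conj (E : HilbertBimodule A B X) (π : B →⋆ₙₐ[ℂ] (H →L[ℂ] H)) (z w : X ⊗[ℂ] H) :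
    conj (E.preForm π w z) = E.preForm π z w := by
  induction z with
  | zero => simp
  | add z₁ z₂ h₁ h₂ => simp [h₁, h₂]
  | tmul x ξ =>
    induction w with
    | zero => simp
    | add w₁ w₂ h₁ h₂ => simp [h₁, h₂]
    | tmul y η =>
      rw [preForm_tmul, preForm_tmul, inner_conj_symm, ← E.star_rinner x y, map_star,
        ContinuousLinearMap.star_eq_adjoint, ContinuousLinearMap.adjoint_inner_left]

lemma exists_negPart {C : Type*} [NonUnitalCStarAlgebra C] [PartialOrder C] [StarOrderedRing C]
    (G : C) (hG : IsSelfAdjoint G) :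
    ∃ N : C, 0 ≤ N ∧ N * G * N = -(star N * N * N) ∧ (N = 0 → 0 ≤ G) := by
  have hN0 : 0 ≤ G⁻ := CFC.negPart_nonneg G
  have hdec : G⁺ - G⁻ = G := CFC.posPart_sub_negPart G hG
  refine ⟨G⁻, hN0, ?_, fun h => ?_⟩
  · rw [(IsSelfAdjoint.of_nonneg hN0).star_eq]
    have : G⁻ * G = -(G⁻ * G⁻) := by
      calc G⁻ * G = G⁻ * (G⁺ - G⁻) := by rw [hdec]
        _ = -(G⁻ * G⁻) := by rw [mul_sub, CFC.negPart_mul_posPart, zero_sub]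
    rw [this, neg_mul]
  · rw [← hdec, h, sub_zero]
    exact CFC.posPart_nonneg G

lemma exists_eq_star_mul_self {C : Type*} [NonUnitalCStarAlgebra C] [PartialOrder C]
    [StarOrderedRing C] (G : C) (hG : 0 ≤ G) : ∃ M : C, G = star M * M :=
  CStarAlgebra.nonneg_iff_eq_star_mul_self.1 hG

/-- The Gram matrix `(⟨x_i, x_j⟩_B)` is positive, hence of the form `M* M`. -/
lemma exists_gram_eq (E : HilbertBimodule A B X) {n : ℕ} (x : Fin n → X) :
    ∃ M : Fin n → Fin n → B,
      ∀ i j, E.rinner (x i) (x j) = ∑ k, star (M k i) * M k j := by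
  set G : CStarMatrix (Fin n) (Fin n) B :=
    CStarMatrix.ofMatrix (Matrix.of fun i j => E.rinner (x i) (x j)) with hG
  have hGa : ∀ i j, G i j = E.rinner (x i) (x j) := fun _ _ => rfl
  have hGs : IsSelfAdjoint G := by
    ext i j
    rw [CStarMatrix.star_apply, hGa, hGa, E.star_rinner]
  obtain ⟨N, hN0, hNG, hNz⟩ := exists_negPart G hGs
  have hNs : star N = N := (IsSelfAdjoint.of_nonneg hN0).star_eq
  have hN3 : 0 ≤ star N * N * N := star_left_conjugate_nonneg hN0 N
  obtain ⟨K, hK⟩ := exists_eq_star_mul_self _ hN3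
  have hK0 : K = 0 := by
    have hdiag : ∀ k, (∑ j, star (K j k) * K j k) = 0 := by
      intro k
      have e1 : (star N * N * N) k k = ∑ j, star (K j k) * K j k := by
        rw [hK, CStarMatrix.mul_apply]
        simp [CStarMatrix.star_apply]
      refine le_antisymm ?_ (Finset.sum_nonneg fun j _ => star_mul_self_nonneg _)
      have e2 : (N * G * N) k k =
          E.rinner (∑ j, E.ract (x j) (N j k)) (∑ j, E.ract (x j) (N j k)) := by
        have r1 : ∀ (z : X) (f : Fin n → X), E.rinner z (∑ j, f j) = ∑ j, E.rinner z (f j) :=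
          fun z f => map_sum (AddMonoidHom.mk' (E.rinner z) (E.rinner_add_right z)) f _
        have r2 : ∀ (z : X) (f : Fin n → X), E.rinner (∑ j, f j) z = ∑ j, E.rinner (f j) z :=
          fun z f => map_sum (AddMonoidHom.mk' (fun y => E.rinner y z)
            fun y y' => E.rinner_add_left y y' z) f _
        simp only [r1, r2, CStarMatrix.mul_apply, Finset.sum_mul, E.rinner_ract,
          E.rinner_ract_left, hGa]
        refine Finset.sum_congr rfl fun j _ => Finset.sum_congr rfl fun i _ => ?_
        rw [← CStarMatrix.star_apply (f := N), hNs]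
      have e3 := E.rinner_self_nonneg (∑ j, E.ract (x j) (N j k))
      rw [← e2, hNG, CStarMatrix.neg_apply, e1] at e3
      exact neg_nonneg.1 e3
    ext j k
    have := (Finset.sum_eq_zero_iff_of_nonneg (fun j _ => star_mul_self_nonneg _)).1 (hdiag k) j
      (Finset.mem_univ _)
    simpa using (CStarRing.star_mul_self_eq_zero_iff _).1 this
  have hN0' : N = 0 := by
    rw [hK0, mul_zero, hNs] at hK
    have h2 : star (N * N) * (N * N) = 0 := by rw [star_mul, hNs, ← mul_assoc, hK, zero_mul]
    have h3 : star N * N = 0 := by rw [hNs]; exact (CStarRing.star_mul_self_eq_zero_iff _).1 h2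
    exact (CStarRing.star_mul_self_eq_zero_iff _).1 h3
  have hG0 : 0 ≤ G := hNz hN0'
  obtain ⟨M, hM⟩ := exists_eq_star_mul_self _ hG0
  refine ⟨fun i j => M i j, fun i j => ?_⟩
  rw [← hGa, hM, CStarMatrix.mul_apply]
  simp [CStarMatrix.star_apply]

lemma preForm_nonneg (E : HilbertBimodule A B X) (π : B →⋆ₙₐ[ℂ] (H →L[ℂ] H)) (z : X ⊗[ℂ] H) :
    0 ≤ (E.preForm π z z).re := by
  obtain ⟨n, x, ξ, rfl⟩ := TensorProduct.exists_sum_tmul_eq z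
  obtain ⟨M, hM⟩ := E.exists_gram_eq x
  have key : E.preForm π (∑ j, x j ⊗ₜ ξ j) (∑ j, x j ⊗ₜ ξ j) =
      ∑ k, inner ℂ (∑ j, π (M k j) (ξ j)) (∑ j, π (M k j) (ξ j)) := by
    have h : ∀ i j, E.preForm π (x i ⊗ₜ ξ i) (x j ⊗ₜ ξ j) =
        ∑ k, inner ℂ (π (M k i) (ξ i)) (π (M k j) (ξ j)) := by
      intro i j
      have h' : ∀ (a b : B) (η ζ : H),
          inner ℂ η (π (star a * b) ζ) = inner ℂ (π a η) (π b ζ) := by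
        intro a b η ζ
        rw [map_mul π, map_star π, ContinuousLinearMap.star_eq_adjoint]
        exact ContinuousLinearMap.adjoint_inner_right (π a) η (π b ζ)
      rw [preForm_tmul, hM]
      simp only [map_sum π, sum_apply, inner_sum, h']
    have e1 : E.preForm π (∑ j, x j ⊗ₜ ξ j) (∑ j, x j ⊗ₜ ξ j) =
        ∑ i, ∑ j, ∑ k, inner ℂ (π (M k i) (ξ i)) (π (M k j) (ξ j)) := by
      rw [map_sum, Finset.sum_comm]
      refine Finset.sum_congr rfl fun j _ => ?_
      rw [map_sum, LinearMap.sum_apply]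
      exact Finset.sum_congr rfl fun i _ => h i j
    have e2 : ∀ k, inner ℂ (∑ j, π (M k j) (ξ j)) (∑ j, π (M k j) (ξ j)) =
        ∑ i, ∑ j, inner ℂ (π (M k i) (ξ i)) (π (M k j) (ξ j)) := by
      intro k
      rw [sum_inner]
      exact Finset.sum_congr rfl fun i _ => inner_sum _ _ _
    rw [e1, Finset.sum_congr rfl fun k _ => e2 k, Finset.sum_comm]
    rw [Finset.sum_comm]
    conv_rhs => rw [Finset.sum_comm]
    exact Finset.sum_congr rfl fun i _ => Finset.sum_comm
  rw [key, Complex.re_sum]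
  exact Finset.sum_nonneg fun k _ => inner_self_nonneg (𝕜 := ℂ)

/-- The semi-inner product on `X ⊙ H`. -/
@[reducible]
def preCore (E : HilbertBimodule A B X) (π : B →⋆ₙₐ[ℂ] (H →L[ℂ] H)) :
    PreInnerProductSpace.Core ℂ (X ⊗[ℂ] H) where
  inner z w := E.preForm π z w
  conj_inner_symm z w := E.preForm_conj π z w
  re_inner_nonneg z := E.preForm_nonneg π z
  add_left _ _ _ := by simp
  smul_left _ _ _ := by simp

/-- The algebraic tensor product `X ⊙ H` with the semi-inner product of `preCore`. -/
@[nolint unusedArguments]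
def PreInduced (_E : HilbertBimodule A B X) (_π : B →⋆ₙₐ[ℂ] (H →L[ℂ] H)) : Type _ := X ⊗[ℂ] H

instance (E : HilbertBimodule A B X) (π : B →⋆ₙₐ[ℂ] (H →L[ℂ] H)) :
    SeminormedAddCommGroup (E.PreInduced π) :=
  @InnerProductSpace.Core.toSeminormedAddCommGroup ℂ (X ⊗[ℂ] H) _ _ _ (E.preCore π)

instance (E : HilbertBimodule A B X) (π : B →⋆ₙₐ[ℂ] (H →L[ℂ] H)) :
    InnerProductSpace ℂ (E.PreInduced π) :=
  @InnerProductSpace.ofCore ℂ (X ⊗[ℂ] H) _ _ _ (E.preCore π)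

/-- The Hilbert space `X ⊗_B H`: the Hausdorff completion of `X ⊙ H`. -/
abbrev Induced (E : HilbertBimodule A B X) (π : B →⋆ₙₐ[ℂ] (H →L[ℂ] H)) : Type _ :=
  UniformSpace.Completion (E.PreInduced π)

/-- The elementary tensor `x ⊗ ξ` in `X ⊗_B H`. -/
def tensor (E : HilbertBimodule A B X) (π : B →⋆ₙₐ[ℂ] (H →L[ℂ] H)) (x : X) (ξ : H) :
    E.Induced π :=
  ((show E.PreInduced π from x ⊗ₜ[ℂ] ξ) : UniformSpace.Completion (E.PreInduced π))

lemma inner_tensor (E : HilbertBimodule A B X) (π : B →⋆ₙₐ[ℂ] (H →L[ℂ] H)) (x y : X) (ξ η : H) :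
    inner ℂ (E.tensor π x ξ) (E.tensor π y η) = inner ℂ ξ (π (E.rinner x y) η) :=
  UniformSpace.Completion.inner_coe _ _

/-- The closed subspace `Y ⊗_B H` of `X ⊗_B H`, for a subspace `Y` of `X`. -/
def subInduced (E : HilbertBimodule A B X) (π : B →⋆ₙₐ[ℂ] (H →L[ℂ] H)) (Y : Submodule ℂ X) :
    Submodule ℂ (E.Induced π) :=
  (Submodule.span ℂ {ζ | ∃ x ∈ Y, ∃ ξ : H, ζ = E.tensor π x ξ}).topologicalClosure

end HilbertBimodule

end

/-!
Write `K = X ⊗_B H`. The operators `x ⊗ ξ ↦ (a x) ⊗ ξ` and `x ⊗ ξ ↦ (a* x) ⊗ ξ` are formally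
adjoint to each other, since the left action is adjointable for `⟨·,·⟩_B`
(`HilbertBimodule.rinner_lact`). A formal `*`-representation of a C⋆-algebra on a pre-Hilbert space
is automatically contractive (`norm_apply_le_of_formal_adjoint`), which gives `π^X`. It is
nondegenerate because `X` is full and `π` is nondegenerate, and `π^X(A_s) K = X_s ⊗_B H` because
`A_s X = X_s`.

Each `V^X_s` comes from the fact that two families of vectors with equal Gram matrices are related
by a partial isometry between their closed spans (`exists_isPartialIsometry_of_inner_eq`), applied
to the vectors `x ⊗ ξ` and `φ_s(x) ⊗ V_s ξ` with `x ∈ X_{s*}`. The Gram matrices agree because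
`⟨φ_s(x), φ_s(y)⟩_B = β_s(⟨x, y⟩_B)` and `π(β_s(b)) V_s = V_s π(b)`. In particular neither
linearity nor continuity of `φ_s` has to be known. The vectors `φ_s(x) ⊗ V_s ξ` exhaust the
elementary tensors of `X_s ⊗_B H`, since `φ_s` is onto `X_s` and `y ⊗ ξ = y ⊗ V_s V_s* ξ` for
`y ∈ X_s = X B_s`. The same Gram matrix principle, applied to `π^X(a) ζ` and `π^X(u a) ζ`, produces
the operator `π^X(u)` of a unitary multiplier `u`.

Covariance amounts to `π^X(α_s(a)) V^X_s = V^X_s π^X(a)`, checked on elementary tensors. For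
`V^X_r V^X_s = π^X(u_{r,s}) V^X_{rs}`, both sides vanish on the orthogonal complement of
`X_{(rs)*} ⊗_B H` (`TwistedMoritaEquivalence.inducedIsometry_inducedIsometry_eq_zero`), and on
`x ⊗ ξ` with `x ∈ X_{(rs)*}` the multiplier `v_{r,s}*` acting on `φ_{rs}(x)` cancels against
`π(v_{r,s})` acting on `V_{rs} ξ`. Uniqueness holds because elementary tensors are total in `K` and
`V^X_s` is prescribed on `X_{s*} ⊗_B H` and on its complement.
-/

/-! ### Partial isometries on a Hilbert space -/

section PartialIsometry

variable {K : Type*} [NormedAddCommGroup K] [InnerProductSpace ℂ K]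

lemma ContinuousLinearMap.eqOn_topologicalClosure_span {s : Set K} {T T' : K →L[ℂ] K}
    (h : Set.EqOn T T' s) : Set.EqOn T T' (Submodule.span ℂ s).topologicalClosure := by
  rw [Submodule.topologicalClosure_coe]
  exact Set.EqOn.closure (fun _ hx => LinearMap.eqOn_span (f := T.toLinearMap)
    (g := T'.toLinearMap) h hx) T.continuous T'.continuous

lemma ContinuousLinearMap.ext_of_eqOn_of_eqOn_orthogonal [CompleteSpace K] {s : Set K}
    {T T' : K →L[ℂ] K} (h : Set.EqOn T T' s)
    (h' : ∀ ζ ∈ (Submodule.span ℂ s).topologicalClosureᗮ, T ζ = T' ζ) : T = T' := by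
  ext ζ
  have hY := Submodule.isClosed_topologicalClosure (Submodule.span ℂ s)
  set Y := (Submodule.span ℂ s).topologicalClosure with hYdef
  have : CompleteSpace Y := hY.completeSpace_coe
  obtain ⟨y, hy, z, hz, rfl⟩ := Y.exists_add_mem_mem_orthogonal ζ
  rw [map_add, map_add, h' z hz, eqOn_topologicalClosure_span h hy]

variable [CompleteSpace K] {V : K →L[ℂ] K}

lemma apply_eq_zero_of_mem_orthogonal_initialSpace {ζ : K} (hζ : ζ ∈ (initialSpace V)ᗮ) :
    V ζ = 0 := by
  have hc : IsClosed (V.ker : Set K) := V.isClosed_ker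
  have : CompleteSpace V.ker := hc.completeSpace_coe
  rw [initialSpace, Submodule.orthogonal_orthogonal] at hζ
  exact hζ

lemma IsPartialIsometry.apply_star_apply_of_mem_finalSpace (hV : IsPartialIsometry V) {ζ : K}
    (hζ : ζ ∈ finalSpace V) : V (star V ζ) = ζ := by
  obtain ⟨w, rfl⟩ := hζ
  exact DFunLike.congr_fun hV w

lemma IsPartialIsometry.star_apply_apply_of_mem_initialSpace (hV : IsPartialIsometry V) {ζ : K}
    (hζ : ζ ∈ initialSpace V) : star V (V ζ) = ζ := by
  have h1 : star V (V ζ) - ζ ∈ V.ker := by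
    change V (star V (V ζ) - ζ) = 0
    rw [map_sub, sub_eq_zero]
    exact hV.apply_star_apply_of_mem_finalSpace ⟨ζ, rfl⟩
  have h2 : star V (V ζ) - ζ ∈ V.kerᗮ := by
    refine sub_mem (fun w hw => ?_) hζ
    rw [ContinuousLinearMap.star_eq_adjoint, ContinuousLinearMap.adjoint_inner_right,
      show V w = 0 from hw, inner_zero_left]
  exact sub_eq_zero.1 (inner_self_eq_zero.1 (h2 _ h1))

lemma IsPartialIsometry.sub_star_apply_apply_mem (hV : IsPartialIsometry V) (ζ : K) :
    ζ - star V (V ζ) ∈ (initialSpace V)ᗮ := by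
  refine Submodule.le_orthogonal_orthogonal _ ?_
  change V (ζ - star V (V ζ)) = 0
  rw [map_sub, sub_eq_zero]
  exact (hV.apply_star_apply_of_mem_finalSpace ⟨ζ, rfl⟩).symm

lemma IsPartialIsometry.sub_apply_star_apply_mem (hV : IsPartialIsometry V) (ζ : K) :
    ζ - V (star V ζ) ∈ (finalSpace V)ᗮ := by
  rintro _ ⟨w, rfl⟩
  have h : star V (V (star V ζ)) = star V ζ := by
    have := congrArg star hV
    rw [star_mul, star_mul, star_star] at this
    exact DFunLike.congr_fun this ζ
  change inner ℂ (V w) (ζ - V (star V ζ)) = 0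
  rw [← ContinuousLinearMap.adjoint_inner_right, ← ContinuousLinearMap.star_eq_adjoint, map_sub, h,
    sub_self, inner_zero_right]

/-- Two families of vectors with the same Gram matrix are related by a partial isometry between
their closed spans. -/
lemma exists_isPartialIsometry_of_inner_eq {ι : Type*} (v w : ι → K)
    (h : ∀ i j, inner ℂ (w i) (w j) = inner ℂ (v i) (v j)) :
    ∃ T : K →L[ℂ] K, IsPartialIsometry T ∧
      initialSpace T = (Submodule.span ℂ (Set.range v)).topologicalClosure ∧
      finalSpace T = (Submodule.span ℂ (Set.range w)).topologicalClosure ∧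
      ∀ i, T (v i) = w i := by
  set Y := (Submodule.span ℂ (Set.range v)).topologicalClosure with hY
  have hYc : IsClosed (Y : Set K) := Submodule.isClosed_topologicalClosure _
  have : CompleteSpace Y := hYc.completeSpace_coe
  have hvY : ∀ i, v i ∈ Y := fun i =>
    Submodule.le_topologicalClosure _ (Submodule.subset_span ⟨i, rfl⟩)
  set g : (ι →₀ ℂ) →ₗ[ℂ] K := Finsupp.linearCombination ℂ w with hg
  set f : (ι →₀ ℂ) →ₗ[ℂ] K := Finsupp.linearCombination ℂ v with hf
  have hfr : LinearMap.range f = Submodule.span ℂ (Set.range v) := Finsupp.range_linearCombination ℂ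
  have hfY : ∀ c, f c ∈ Y := fun c =>
    Submodule.le_topologicalClosure _ (hfr ▸ LinearMap.mem_range_self f c)
  set e : (ι →₀ ℂ) →ₗ[ℂ] Y := f.codRestrict Y hfY with he
  have hdense : DenseRange e := by
    intro y
    rw [closure_subtype]
    have : Subtype.val '' Set.range e = (Submodule.span ℂ (Set.range v) : Set K) := by
      rw [← hfr, ← Set.range_comp]
      rfl
    rw [this, ← Submodule.topologicalClosure_coe]
    exact y.2
  -- Equal Gram matrices make `∑ cᵢ vᵢ ↦ ∑ cᵢ wᵢ` isometric, hence well defined on the span.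
  have hnorm : ∀ c, ‖g c‖ = ‖e c‖ := by
    intro c
    have h1 : inner ℂ (g c) (g c) = inner ℂ (f c) (f c) := by
      simp only [hg, hf, Finsupp.linearCombination_apply,
        Finsupp.sum, inner_smul_left, inner_smul_right, h, sum_inner, inner_sum]
    have h2 : ‖e c‖ = ‖f c‖ := rfl
    rw [h2, @norm_eq_sqrt_re_inner ℂ, @norm_eq_sqrt_re_inner ℂ _ _ _ _ (f c), h1]
  have hb : ∃ C, ∀ c, ‖g c‖ ≤ C * ‖e c‖ := ⟨1, fun c => by rw [hnorm, one_mul]⟩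
  set T₀ : Y →L[ℂ] K := g.extendOfNorm e with hT₀
  have hT₀e : ∀ c, T₀ (e c) = g c := LinearMap.extendOfNorm_eq hdense hb
  have hT₀n : ∀ y, ‖T₀ y‖ = ‖y‖ := fun y => hdense.induction_on
    (p := fun y => ‖T₀ y‖ = ‖y‖) y
    (isClosed_eq (by fun_prop) (by fun_prop)) fun c => by rw [hT₀e, hnorm]
  let U : Y →ₗᵢ[ℂ] K := ⟨T₀.toLinearMap, hT₀n⟩
  have hU : ∀ y, U y = T₀ y := fun _ => rfl
  -- `T₀` is the isometry of `Y` into `K`; composing with the projection extends it by zero.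
  set T : K →L[ℂ] K := T₀ ∘L Y.orthogonalProjectionOnto with hT
  have hTapp : ∀ z, T z = T₀ (Y.orthogonalProjectionOnto z) := fun _ => rfl
  have hTT : ∀ z, star T (T z) = Y.orthogonalProjectionOnto z := by
    intro z
    refine ext_inner_right ℂ fun u => ?_
    rw [ContinuousLinearMap.star_eq_adjoint, ContinuousLinearMap.adjoint_inner_left, hTapp, hTapp,
      ← hU, ← hU, U.inner_map_map, Submodule.inner_orthogonalProjectionOnto_eq_of_mem_left]
  have hTy : ∀ y : Y, T y = T₀ y := fun y => by
    rw [hTapp, Submodule.orthogonalProjectionOnto_mem_subspace_eq_self]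
  have hTv : ∀ i, T (v i) = w i := fun i => by
    have h1 : e (Finsupp.single i 1) = ⟨v i, hvY i⟩ := Subtype.ext (by simp [he, hf])
    have h2 := hT₀e (Finsupp.single i 1)
    rw [h1, ← hTy] at h2
    simpa [hg] using h2
  refine ⟨T, ?_, ?_, ?_, hTv⟩
  · ext z
    change T (star T (T z)) = T z
    rw [hTT, hTy, ← hTapp]
  · have : T.ker = Yᗮ := by
      ext z
      change T z = 0 ↔ _
      rw [hTapp, ← norm_eq_zero, hT₀n, norm_eq_zero,
        Submodule.orthogonalProjectionOnto_eq_zero_iff]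
    rw [initialSpace, this, Submodule.orthogonal_orthogonal]
  · have hrange : (finalSpace T : Set K) = Set.range T₀ := by
      ext z
      constructor
      · rintro ⟨x, rfl⟩
        exact ⟨_, rfl⟩
      · rintro ⟨y, rfl⟩
        exact ⟨y, hTy y⟩
    have hclosed : IsClosed (finalSpace T : Set K) := by
      rw [hrange]
      exact U.isometry.isClosedEmbedding.isClosed_range
    apply le_antisymm
    · intro z hz
      have hz' : z ∈ Set.range T₀ := hrange ▸ hz
      obtain ⟨y, rfl⟩ := hz'
      refine hdense.induction_on
        (p := fun y => T₀ y ∈ (Submodule.span ℂ (Set.range w)).topologicalClosure) y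
        ((Submodule.isClosed_topologicalClosure _).preimage T₀.continuous) fun c => ?_
      rw [hT₀e]
      refine Submodule.le_topologicalClosure _ ?_
      rw [← Finsupp.range_linearCombination ℂ]
      exact LinearMap.mem_range_self _ c
    · refine Submodule.topologicalClosure_minimal _ (Submodule.span_le.2 ?_) hclosed
      rintro _ ⟨i, rfl⟩
      exact ⟨v i, hTv i⟩

end PartialIsometry

/-! ### The essential subspace of an ideal, and images of multipliers -/

section EssSpace

variable {A K : Type*} [NonUnitalCStarAlgebra A] [NormedAddCommGroup K] [InnerProductSpace ℂ K]
  [CompleteSpace K] {π : A →⋆ₙₐ[ℂ] (K →L[ℂ] K)} {I : ClosedIdeal A}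

lemma inner_rep_right (π : A →⋆ₙₐ[ℂ] (K →L[ℂ] K)) (a : A) (ξ η : K) :
    inner ℂ ξ (π a η) = inner ℂ (π (star a) ξ) η := by
  rw [map_star, ContinuousLinearMap.star_eq_adjoint, ContinuousLinearMap.adjoint_inner_left]

lemma rep_mul_apply (π : A →⋆ₙₐ[ℂ] (K →L[ℂ] K)) (a b : A) (ξ : K) :
    π (a * b) ξ = π a (π b ξ) := by
  rw [map_mul]
  rfl

lemma apply_mem_essSpace {a : A} (ha : a ∈ I) (ζ : K) : π a ζ ∈ essSpace π I :=
  Submodule.le_topologicalClosure _ (Submodule.subset_span ⟨a, ha, ζ, rfl⟩)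

lemma mem_orthogonal_essSpace_iff {ζ : K} :
    ζ ∈ (essSpace π I)ᗮ ↔ ∀ a ∈ I, π a ζ = 0 := by
  constructor
  · intro h a ha
    refine ext_inner_left ℂ fun w => ?_
    rw [inner_rep_right, inner_zero_right]
    exact h _ (apply_mem_essSpace (star_mem ha) w)
  · intro h
    rw [essSpace, Submodule.orthogonal_closure]
    rw [Submodule.mem_orthogonal]
    intro w hw
    induction hw using Submodule.span_induction with
    | mem w hw =>
      obtain ⟨a, ha, ξ, rfl⟩ := hw
      rw [← inner_conj_symm, inner_rep_right, h _ (star_mem ha), inner_zero_left, map_zero]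
    | zero => simp
    | add x y _ _ hx hy => rw [inner_add_left, hx, hy, add_zero]
    | smul c x _ hx => rw [inner_smul_left, hx, mul_zero]

lemma eq_zero_of_mem_essSpace {ζ : K} (hζ : ζ ∈ essSpace π I) (h : ∀ a ∈ I, π a ζ = 0) :
    ζ = 0 :=
  inner_self_eq_zero.1 (mem_orthogonal_essSpace_iff.2 h ζ hζ)

lemma rep_apply_mem_essSpace (a : A) {ζ : K} (hζ : ζ ∈ essSpace π I) :
    π a ζ ∈ essSpace π I := by
  have hc : IsClosed (essSpace π I : Set K) := Submodule.isClosed_topologicalClosure _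
  have hle : essSpace π I ≤ (essSpace π I).comap (π a).toLinearMap := by
    refine Submodule.topologicalClosure_minimal _ (Submodule.span_le.2 ?_)
      (hc.preimage (π a).continuous)
    rintro _ ⟨b, hb, ξ, rfl⟩
    change π a (π b ξ) ∈ essSpace π I
    rw [← rep_mul_apply]
    exact apply_mem_essSpace (I.mul_mem_left' a hb) ξ
  exact hle hζ

lemma ext_of_apply_rep_eq {T T' : K →L[ℂ] K} (h : ∀ a ∈ I, ∀ ζ, T (π a ζ) = T' (π a ζ))
    (h' : ∀ ζ ∈ (essSpace π I)ᗮ, T ζ = T' ζ) : T = T' := by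
  refine ContinuousLinearMap.ext_of_eqOn_of_eqOn_orthogonal ?_ h'
  rintro _ ⟨a, ha, ξ, rfl⟩
  exact h a ha ξ

lemma multL_of_mem (m : DoubleCentralizer ℂ I) (a : I) : multL m (a : A) = m.fst a := by
  simp [multL, partialApply]

lemma star_fst_fst {m : DoubleCentralizer ℂ I} (hm : m ∈ unitary (DoubleCentralizer ℂ I))
    (b : I) : (star m).fst (m.fst b) = b := by
  have := DFunLike.congr_fun (congrArg (fun n : DoubleCentralizer ℂ I => n.fst)
    (Unitary.mem_iff.1 hm).1) b
  simpa [DoubleCentralizer.mul_fst, DoubleCentralizer.one_fst] using this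

/-- A unitary multiplier preserves the products `a* b`. -/
lemma star_fst_mul_fst {m : DoubleCentralizer ℂ I} (hm : m ∈ unitary (DoubleCentralizer ℂ I))
    (a b : I) : star (m.fst a : A) * (m.fst b : A) = star (a : A) * (b : A) := by
  have h1 : star (m.fst a) = (star m).snd (star a) := by
    rw [DoubleCentralizer.star_snd, star_star]
  have h3 : star (m.fst a) * m.fst b = star a * b := by
    rw [h1, (star m).central, star_fst_fst hm]
  exact congrArg Subtype.val h3

/-- A unitary multiplier `m` of `I` has an image `π(m)` in every representation. -/
lemma exists_isMultiplierImage (π : A →⋆ₙₐ[ℂ] (K →L[ℂ] K)) {m : DoubleCentralizer ℂ I}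
    (hm : m ∈ unitary (DoubleCentralizer ℂ I)) : ∃ T, IsMultiplierImage π m T := by
  obtain ⟨T, -, hT, -, hTv⟩ := exists_isPartialIsometry_of_inner_eq
    (fun p : I × K => π (p.1 : A) p.2) (fun p : I × K => π (m.fst p.1 : A) p.2) (by
      rintro ⟨a, ξ⟩ ⟨b, η⟩
      dsimp only
      rw [inner_rep_right, inner_rep_right, ← rep_mul_apply, ← rep_mul_apply,
        star_fst_mul_fst hm])
  have hess : initialSpace T = essSpace π I := by
    rw [hT, essSpace]
    congr 2
    ext η
    constructor
    · rintro ⟨⟨a, ξ⟩, rfl⟩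
      exact ⟨a, a.2, ξ, rfl⟩
    · rintro ⟨a, ha, ξ, rfl⟩
      exact ⟨(⟨a, ha⟩, ξ), rfl⟩
  refine ⟨T, fun a ha ξ => ?_, fun η hη => ?_⟩
  · rw [multL_of_mem m ⟨a, ha⟩]
    exact hTv (⟨a, ha⟩, ξ)
  · exact apply_eq_zero_of_mem_orthogonal_initialSpace (hess ▸ hη)

/-- The relation `π(b m*) π(m) = π(b)` for a unitary multiplier `m` of `I` and `b ∈ I`. -/
lemma IsMultiplierImage.rep_snd_star_apply {m : DoubleCentralizer ℂ I}
    (hm : m ∈ unitary (DoubleCentralizer ℂ I)) {T : K →L[ℂ] K} (hT : IsMultiplierImage π m T)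
    (b : I) (η : K) : π ((star m).snd b : A) (T η) = π (b : A) η := by
  refine DFunLike.congr_fun (ext_of_apply_rep_eq (π := π) (I := I)
    (T := π ((star m).snd b : A) ∘L T) (T' := π (b : A)) (fun a ha ζ => ?_) fun ζ hζ => ?_) η
  · change π ((star m).snd b : A) (T (π a ζ)) = π (b : A) (π a ζ)
    rw [hT.1 a ha, multL_of_mem m ⟨a, ha⟩, ← rep_mul_apply, ← rep_mul_apply]
    have h : (star m).snd b * m.fst ⟨a, ha⟩ = b * ⟨a, ha⟩ := by
      rw [(star m).central, star_fst_fst hm]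
    exact congrArg (fun c => π c ζ) (congrArg Subtype.val h)
  · change π ((star m).snd b : A) (T ζ) = π (b : A) ζ
    rw [hT.2 ζ hζ, map_zero, mem_orthogonal_essSpace_iff.1 hζ b b.2]

end EssSpace

/-! ### Bounded representations from formal adjoints -/

section FormalAdjoint

variable {A E K : Type*} [NonUnitalCStarAlgebra A] [AddCommGroup E] [Module ℂ E]
  [NormedAddCommGroup K] [InnerProductSpace ℂ K]

attribute [local instance] CStarAlgebra.spectralOrder CStarAlgebra.spectralOrderedRing

/-- In the unitization of `A`, `‖a‖² - a* a = c* c`. -/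
lemma exists_unitization_star_mul_self (a : A) : ∃ (l : ℂ) (b : A),
    (‖a‖ ^ 2 : ℝ) = conj l * l ∧
      -(star a * a) = conj l • b + l • star b + star b * b := by
  have h : 0 ≤ algebraMap ℝ (Unitization ℂ A) (‖(a : Unitization ℂ A)‖ ^ 2)
      - star (a : Unitization ℂ A) * (a : Unitization ℂ A) :=
    sub_nonneg.2 CStarAlgebra.star_mul_le_algebraMap_norm_sq
  obtain ⟨c, hc⟩ := CStarAlgebra.nonneg_iff_eq_star_mul_self.1 h
  rw [Unitization.norm_inr] at hc
  refine ⟨c.fst, c.snd, ?_, ?_⟩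
  · have := congrArg (fun c => c.fst) hc
    simpa [Algebra.algebraMap_eq_smul_one, sub_eq_add_neg] using this
  · have := congrArg (fun c => c.snd) hc
    simpa [Algebra.algebraMap_eq_smul_one, sub_eq_add_neg] using this

/-- A multiplicative family of operators on a pre-Hilbert space, in which `T a` and `T (star a)`
are formally adjoint to each other, is contractive: writing `‖a‖² - a* a = c* c` in the
unitization of `A`, the difference `‖a‖² ‖z‖² - ‖T a z‖²` is the norm squared of `T c z`,
where `T` is extended to the unitization by `T 1 = id`. -/
lemma norm_apply_le_of_formal_adjoint (e : E →ₗ[ℂ] K) (T : A →ₗ[ℂ] E →ₗ[ℂ] E)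
    (hmul : ∀ a b z, T (a * b) z = T a (T b z))
    (hadj : ∀ a z w, inner ℂ (e (T a z)) (e w) = inner ℂ (e z) (e (T (star a) w)))
    (a : A) (z : E) : ‖e (T a z)‖ ≤ ‖a‖ * ‖e z‖ := by
  obtain ⟨l, b, h1, h2⟩ := exists_unitization_star_mul_self a
  have h3 : inner ℂ (e (T a z)) (e (T a z)) = inner ℂ (e z) (e (T (star a * a) z)) := by
    rw [hadj, hmul]
  have h4 : inner ℂ (e (l • z + T b z)) (e (l • z + T b z)) =
      (‖a‖ ^ 2 : ℝ) * inner ℂ (e z) (e z) - inner ℂ (e (T a z)) (e (T a z)) := by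
    have h5 : T (star a * a) z = -(conj l • T b z + l • T (star b) z + T (star b) (T b z)) := by
      rw [← neg_neg (star a * a), h2]
      simp only [map_neg, map_add, map_smul, LinearMap.neg_apply, LinearMap.add_apply,
        LinearMap.smul_apply, hmul]
    rw [h3, h5, h1]
    simp only [map_add, map_smul, map_neg, inner_add_left, inner_add_right, inner_smul_left,
      inner_smul_right, inner_neg_right, hadj]
    ring
  have h6 : 0 ≤ RCLike.re (inner ℂ (e (l • z + T b z)) (e (l • z + T b z)) : ℂ) :=
    inner_self_nonneg
  rw [h4, map_sub, inner_self_eq_norm_sq_to_K, inner_self_eq_norm_sq_to_K] at h6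
  have h7 : 0 ≤ ‖a‖ ^ 2 * ‖e z‖ ^ 2 - ‖e (T a z)‖ ^ 2 := by
    simpa [← Complex.ofReal_pow, ← Complex.ofReal_mul] using h6
  rw [← abs_of_nonneg (norm_nonneg (e (T a z))), ← abs_of_nonneg (by positivity : 0 ≤ ‖a‖ * ‖e z‖)]
  rw [← sq_le_sq, mul_pow]
  linarith

/-- Operators as in `norm_apply_le_of_formal_adjoint` with dense range of `e` extend to a
representation of `A` on `K`. -/
lemma exists_rep_of_formal_adjoint [CompleteSpace K] (e : E →ₗ[ℂ] K) (he : DenseRange e)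
    (T : A →ₗ[ℂ] E →ₗ[ℂ] E) (hmul : ∀ a b z, T (a * b) z = T a (T b z))
    (hadj : ∀ a z w, inner ℂ (e (T a z)) (e w) = inner ℂ (e z) (e (T (star a) w))) :
    ∃ π : A →⋆ₙₐ[ℂ] (K →L[ℂ] K), ∀ a z, π a (e z) = e (T a z) := by
  have h : ∀ a, ∃ P : K →L[ℂ] K, ∀ z, P (e z) = e (T a z) := fun a =>
    ⟨(e ∘ₗ T a).extendOfNorm e, fun z => LinearMap.extendOfNorm_eq he
      ⟨‖a‖, norm_apply_le_of_formal_adjoint e T hmul hadj a⟩ z⟩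
  choose P hP using h
  have hext : ∀ Q Q' : K →L[ℂ] K, (∀ z, Q (e z) = Q' (e z)) → Q = Q' := fun Q Q' h =>
    DFunLike.coe_injective (he.equalizer Q.continuous Q'.continuous (funext h))
  refine ⟨{ toFun := P
            map_smul' := fun c a => hext _ _ fun z => ?_
            map_zero' := hext _ _ fun z => ?_
            map_add' := fun a b => hext _ _ fun z => ?_
            map_mul' := fun a b => hext _ _ fun z => ?_
            map_star' := fun a => ?_ }, fun a z => hP a z⟩
  · simp [hP]
  · simp [hP]
  · simp [hP]
  · change P (a * b) (e z) = P a (P b (e z))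
    rw [hP, hP, hP, hmul]
  · refine hext _ _ fun z => ?_
    rw [hP]
    refine he.eq_of_inner_right ℂ fun w => ?_
    rw [ContinuousLinearMap.star_eq_adjoint, ContinuousLinearMap.adjoint_inner_right, hP, hadj]

end FormalAdjoint

/-! ### Elementary tensors in the induced Hilbert space -/

namespace HilbertBimodule

variable {A B X H : Type*}
  [NonUnitalCStarAlgebra A] [PartialOrder A] [StarOrderedRing A]
  [NonUnitalCStarAlgebra B] [PartialOrder B] [StarOrderedRing B]
  [AddCommGroup X] [Module ℂ X] [NormedAddCommGroup H] [InnerProductSpace ℂ H] [CompleteSpace H]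
  (E : HilbertBimodule A B X) (π : B →⋆ₙₐ[ℂ] (H →L[ℂ] H))

/-- The left action is adjointable for the right inner product, because `z · ⟨a x, y⟩` and
`z · ⟨x, a* y⟩` both equal `⟨z, x⟩ a* y`. -/
lemma rinner_lact (a : A) (x y : X) : E.rinner (E.lact a x) y = E.rinner x (E.lact (star a) y) := by
  have h1 : ∀ z, E.ract z (E.rinner (E.lact a x) y) =
      E.ract z (E.rinner x (E.lact (star a) y)) := by
    intro z
    have h : E.linner z (E.lact a x) = E.linner z x * star a := by
      rw [← E.star_linner, E.linner_lact, star_mul, E.star_linner]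
    rw [← E.linner_lact_eq, ← E.linner_lact_eq, h, E.lact_mul]
  set d := E.rinner (E.lact a x) y - E.rinner x (E.lact (star a) y) with hd
  have h2 : ∀ w z, E.rinner w z * d = 0 := by
    intro w z
    rw [← E.rinner_ract, hd, map_sub, h1, sub_self, E.rinner_zero_right]
  have h3 : star d * d = 0 := by
    have : star d = E.rinner y (E.lact a x) - E.rinner (E.lact (star a) y) x := by
      rw [hd, star_sub, E.star_rinner, E.star_rinner]
    rw [this, sub_mul, h2, h2, sub_zero]
  exact sub_eq_zero.1 ((CStarRing.star_mul_self_eq_zero_iff _).1 h3)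

/-- The canonical map from the algebraic tensor product to `X ⊗_B H`. -/
noncomputable def toInduced : X ⊗[ℂ] H →ₗ[ℂ] E.Induced π :=
  (UniformSpace.Completion.toComplL (𝕜 := ℂ) (E := E.PreInduced π)).toLinearMap

lemma toInduced_tmul (x : X) (ξ : H) : E.toInduced π (x ⊗ₜ ξ) = E.tensor π x ξ := rfl

lemma denseRange_toInduced : DenseRange (E.toInduced π) :=
  UniformSpace.Completion.denseRange_coe (α := E.PreInduced π)

lemma topologicalClosure_span_tensor :
    (Submodule.span ℂ {ζ | ∃ x ξ, ζ = E.tensor π x ξ}).topologicalClosure = ⊤ := by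
  refine Submodule.dense_iff_topologicalClosure_eq_top.1
    (Dense.mono (s₁ := Set.range (E.toInduced π)) ?_ (E.denseRange_toInduced π))
  rintro _ ⟨z, rfl⟩
  induction z with
  | zero => rw [map_zero]; exact zero_mem _
  | add z w hz hw => rw [map_add]; exact add_mem hz hw
  | tmul x ξ => exact Submodule.subset_span ⟨x, ξ, rfl⟩

variable {E π}

lemma ext_tensor {T T' : E.Induced π →L[ℂ] E.Induced π}
    (h : ∀ x ξ, T (E.tensor π x ξ) = T' (E.tensor π x ξ)) : T = T' := by
  ext ζ
  refine ContinuousLinearMap.eqOn_topologicalClosure_span (s := {ζ | ∃ x ξ, ζ = E.tensor π x ξ}) ?_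
    (x := ζ) ?_
  · rintro _ ⟨x, ξ, rfl⟩
    exact h x ξ
  · rw [topologicalClosure_span_tensor]
    trivial

lemma ext_inner_tensor {ζ ζ' : E.Induced π}
    (h : ∀ x ξ, inner ℂ (E.tensor π x ξ) ζ = inner ℂ (E.tensor π x ξ) ζ') : ζ = ζ' := by
  refine (E.denseRange_toInduced π).eq_of_inner_right ℂ fun z => ?_
  induction z with
  | zero => simp
  | add z w hz hw => simp only [map_add, inner_add_left, hz, hw]
  | tmul x ξ => exact h x ξ

lemma tensor_ract (x : X) (b : B) (ξ : H) :
    E.tensor π (E.ract x b) ξ = E.tensor π x (π b ξ) := by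
  refine ext_inner_tensor fun y η => ?_
  rw [inner_tensor, inner_tensor, E.rinner_ract, rep_mul_apply]

lemma continuous_tensor (x : X) : Continuous fun ξ => E.tensor π x ξ := by
  refine AddMonoidHomClass.continuous_of_bound (E.toInduced π ∘ₗ TensorProduct.mk ℂ X H x)
    (√‖π (E.rinner x x)‖) fun ξ => ?_
  change ‖E.tensor π x ξ‖ ≤ _
  rw [@norm_eq_sqrt_re_inner ℂ, inner_tensor]
  refine Real.sqrt_le_iff.2 ⟨by positivity, ?_⟩
  rw [mul_pow, Real.sq_sqrt (norm_nonneg _)]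
  calc RCLike.re (inner ℂ ξ (π (E.rinner x x) ξ)) ≤ ‖ξ‖ * ‖π (E.rinner x x) ξ‖ :=
        re_inner_le_norm _ _
    _ ≤ ‖ξ‖ * (‖π (E.rinner x x)‖ * ‖ξ‖) := by
        gcongr
        exact (π (E.rinner x x)).le_opNorm ξ
    _ = ‖π (E.rinner x x)‖ * ‖ξ‖ ^ 2 := by ring

variable (E π) in
/-- The left action of `A` on `X` induces a representation of `A` on `X ⊗_B H`. -/
lemma exists_inducedRep : ∃ σ : A →⋆ₙₐ[ℂ] (E.Induced π →L[ℂ] E.Induced π),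
    ∀ a x ξ, σ a (E.tensor π x ξ) = E.tensor π (E.lact a x) ξ := by
  have hmul : ∀ a b (z : X ⊗[ℂ] H), (E.lact (a * b)).rTensor H z =
      (E.lact a).rTensor H ((E.lact b).rTensor H z) := by
    intro a b z
    rw [← LinearMap.comp_apply, ← LinearMap.rTensor_comp]
    congr 2
    ext x
    exact E.lact_mul a b x
  have hadj : ∀ a (z w : X ⊗[ℂ] H),
      inner ℂ (E.toInduced π ((E.lact a).rTensor H z)) (E.toInduced π w) =
        inner ℂ (E.toInduced π z) (E.toInduced π ((E.lact (star a)).rTensor H w)) := by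
    intro a z w
    induction z with
    | zero => simp
    | add z z' hz hz' => simp only [map_add, inner_add_left, hz, hz']
    | tmul x ξ =>
      induction w with
      | zero => simp
      | add w w' hw hw' => simp only [map_add, inner_add_right, hw, hw']
      | tmul y η =>
        rw [LinearMap.rTensor_tmul, LinearMap.rTensor_tmul, toInduced_tmul, toInduced_tmul,
          toInduced_tmul, toInduced_tmul, inner_tensor, inner_tensor, E.rinner_lact]
  obtain ⟨σ, hσ⟩ := exists_rep_of_formal_adjoint (E.toInduced π) (E.denseRange_toInduced π)
    (LinearMap.rTensorHom H ∘ₗ E.lact) hmul hadj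
  exact ⟨σ, fun a x ξ => hσ a (x ⊗ₜ ξ)⟩

variable (E π) in
/-- The representation of `A` on `X ⊗_B H` induced from `π` by the left action. -/
noncomputable def inducedRep : A →⋆ₙₐ[ℂ] (E.Induced π →L[ℂ] E.Induced π) :=
  (E.exists_inducedRep π).choose

lemma inducedRep_tensor (a : A) (x : X) (ξ : H) :
    E.inducedRep π a (E.tensor π x ξ) = E.tensor π (E.lact a x) ξ :=
  (E.exists_inducedRep π).choose_spec a x ξ

/-- Since `⟨x, y⟩_A z ⊗ ξ = x ⊗ π(⟨y, z⟩_B) ξ`, right fullness of `X` and nondegeneracy of `π`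
place every elementary tensor in the closed span of the range of the induced representation. -/
lemma isNondegenerateRep_inducedRep (hE : E.IsImprimitivity) (hπ : IsNondegenerateRep π) :
    IsNondegenerateRep (E.inducedRep π) := by
  rw [IsNondegenerateRep, eq_top_iff]
  set N := (Submodule.span ℂ {η : E.Induced π | ∃ (a : A) (ξ : E.Induced π),
    η = E.inducedRep π a ξ}).topologicalClosure with hN
  have hNc : IsClosed (N : Set (E.Induced π)) := Submodule.isClosed_topologicalClosure _
  have h1 : ∀ (x : X) (b : B) (ξ : H), E.tensor π x (π b ξ) ∈ N := by
    intro x b ξ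
    let L : B →ₗ[ℂ] E.Induced π := (E.toInduced π ∘ₗ TensorProduct.mk ℂ X H x) ∘ₗ
      { toFun := fun b => π b ξ, map_add' := by simp, map_smul' := by simp }
    have hL : Continuous L := (continuous_tensor (E := E) (π := π) x).comp
      ((ContinuousLinearMap.apply ℂ H ξ).continuous.comp (map_continuous π))
    have hcl : IsClosed (N.comap L : Set B) := hNc.preimage hL
    have hle : Submodule.span ℂ {b : B | ∃ y z, b = E.rinner y z} ≤ N.comap L := by
      refine Submodule.span_le.2 ?_
      rintro _ ⟨y, z, rfl⟩
      change E.tensor π x (π (E.rinner y z) ξ) ∈ N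
      rw [← tensor_ract, ← E.linner_lact_eq, ← inducedRep_tensor]
      exact Submodule.le_topologicalClosure _ (Submodule.subset_span ⟨_, _, rfl⟩)
    exact closure_minimal hle hcl (hE.2 ▸ Set.mem_univ b)
  rw [← topologicalClosure_span_tensor]
  refine Submodule.topologicalClosure_minimal _ (Submodule.span_le.2 ?_) hNc
  rintro _ ⟨x, ξ, rfl⟩
  let L : H →ₗ[ℂ] E.Induced π := E.toInduced π ∘ₗ TensorProduct.mk ℂ X H x
  have hcl : IsClosed (N.comap L : Set H) :=
    hNc.preimage (continuous_tensor (E := E) (π := π) x)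
  have hle : (⊤ : Submodule ℂ H) ≤ N.comap L := by
    rw [← hπ]
    refine Submodule.topologicalClosure_minimal _ (Submodule.span_le.2 ?_) hcl
    rintro _ ⟨b, η, rfl⟩
    exact h1 x b η
  exact hle (Submodule.mem_top (x := ξ))

/-- If `Y = I · X`, then `π^X(I) (X ⊗_B H) = Y ⊗_B H`. -/
lemma essSpace_inducedRep {I : ClosedIdeal A} {Y : Submodule ℂ X}
    (hY : ∀ x, x ∈ Y ↔ ∃ a ∈ I, ∃ y, x = E.lact a y) :
    essSpace (E.inducedRep π) I = E.subInduced π Y := by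
  apply le_antisymm
  · refine Submodule.topologicalClosure_minimal _ (Submodule.span_le.2 ?_)
      (Submodule.isClosed_topologicalClosure _)
    rintro _ ⟨a, ha, ζ, rfl⟩
    have hle : (⊤ : Submodule ℂ (E.Induced π)) ≤
        (E.subInduced π Y).comap (E.inducedRep π a).toLinearMap := by
      rw [← topologicalClosure_span_tensor]
      refine Submodule.topologicalClosure_minimal _ (Submodule.span_le.2 ?_)
        ((Submodule.isClosed_topologicalClosure _).preimage (E.inducedRep π a).continuous)
      rintro _ ⟨x, ξ, rfl⟩
      change E.inducedRep π a (E.tensor π x ξ) ∈ E.subInduced π Y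
      rw [inducedRep_tensor]
      exact Submodule.le_topologicalClosure _
        (Submodule.subset_span ⟨_, (hY _).2 ⟨a, ha, x, rfl⟩, ξ, rfl⟩)
    exact hle (Submodule.mem_top (x := ζ))
  · refine Submodule.topologicalClosure_mono (Submodule.span_mono ?_)
    rintro _ ⟨x, hx, ξ, rfl⟩
    obtain ⟨a, ha, y, rfl⟩ := (hY x).1 hx
    exact ⟨a, ha, E.tensor π y ξ, (inducedRep_tensor a y ξ).symm⟩

/-! ### Multipliers and elementary tensors -/

lemma tensor_lmult_lact {I : ClosedIdeal A} {m : DoubleCentralizer ℂ I}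
    {T : E.Induced π →L[ℂ] E.Induced π} (hT : IsMultiplierImage (E.inducedRep π) m T)
    {a : A} (ha : a ∈ I) (x : X) (ξ : H) :
    E.tensor π (E.lmult m (E.lact a x)) ξ = T (E.tensor π (E.lact a x) ξ) := by
  rw [E.lmult_lact m ⟨a, ha⟩, ← inducedRep_tensor, ← inducedRep_tensor, hT.1 a ha,
    multL_of_mem m ⟨a, ha⟩]

/-- The relation `z m* ⊗ π(m) ξ = z ⊗ ξ` for `z ∈ X · J` and a unitary multiplier `m` of `J`. -/
lemma tensor_rmult_star_ract {J : ClosedIdeal B} {m : DoubleCentralizer ℂ J}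
    (hm : m ∈ unitary (DoubleCentralizer ℂ J)) {T : H →L[ℂ] H} (hT : IsMultiplierImage π m T)
    {b : B} (hb : b ∈ J) (x : X) (ξ : H) :
    E.tensor π (E.rmult (star m) (E.ract x b)) (T ξ) = E.tensor π (E.ract x b) ξ := by
  rw [E.rmult_ract (star m) x ⟨b, hb⟩, tensor_ract, tensor_ract,
    hT.rep_snd_star_apply hm ⟨b, hb⟩]

end HilbertBimodule

/-! ### The induced covariant representation -/

lemma partialApply_of_mem {σ τ M N : Type*} [SetLike σ M] [SetLike τ N] [Zero N] {I : σ} {J : τ}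
    (f : I → J) {x : M} (hx : x ∈ I) : partialApply f x = (f ⟨x, hx⟩ : N) := by
  simp [partialApply, hx]

namespace CovariantRep

variable {S A H : Type*} [InverseMonoid S] [NonUnitalCStarAlgebra A] [NormedAddCommGroup H]
  [InnerProductSpace ℂ H] [CompleteSpace H] {β : BusbySmithAction S A} (ρ : CovariantRep β H)

lemma rep_apply_star_apply {s : S} {b : A} (hb : b ∈ β.ideal s⁻¹) (ξ : H) :
    ρ.π b (star (ρ.V s) (ρ.V s ξ)) = ρ.π b ξ := by
  have h := (ρ.isPartialIsometry s).sub_star_apply_apply_mem ξ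
  rw [ρ.initialSpace_eq, mem_orthogonal_essSpace_iff] at h
  have h' := h b hb
  rw [map_sub, sub_eq_zero] at h'
  exact h'.symm

lemma rep_apply_apply_star {s : S} {b : A} (hb : b ∈ β.ideal s) (ξ : H) :
    ρ.π b (ρ.V s (star (ρ.V s) ξ)) = ρ.π b ξ := by
  have h := (ρ.isPartialIsometry s).sub_apply_star_apply_mem ξ
  rw [ρ.finalSpace_eq, mem_orthogonal_essSpace_iff] at h
  have h' := h b hb
  rw [map_sub, sub_eq_zero] at h'
  exact h'.symm

lemma rep_act_apply (s : S) (b : β.ideal s⁻¹) (ξ : H) :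
    ρ.π (β.act s b : A) (ρ.V s ξ) = ρ.V s (ρ.π (b : A) ξ) := by
  rw [ρ.covariant]
  change ρ.V s (ρ.π (b : A) (star (ρ.V s) (ρ.V s ξ))) = _
  rw [ρ.rep_apply_star_apply b.2]

end CovariantRep

namespace TwistedMoritaEquivalence

variable {S A B X H : Type*} [InverseMonoid S]
  [NonUnitalCStarAlgebra A] [PartialOrder A] [StarOrderedRing A]
  [NonUnitalCStarAlgebra B] [PartialOrder B] [StarOrderedRing B]
  [AddCommGroup X] [Module ℂ X]
  [NormedAddCommGroup H] [InnerProductSpace ℂ H] [CompleteSpace H]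
  {α : BusbySmithAction S A} {β : BusbySmithAction S B} (M : TwistedMoritaEquivalence X α β)
  (ρ : CovariantRep β H)

lemma essSpace_inducedRep (s : S) :
    essSpace (M.bimod.inducedRep ρ.π) (α.ideal s) = M.bimod.subInduced ρ.π (M.sub s) :=
  HilbertBimodule.essSpace_inducedRep (M.mem_sub_left s)

lemma rinner_mem {s : S} (x y : M.sub s⁻¹) : M.bimod.rinner x y ∈ β.ideal s⁻¹ := by
  have h := (M.isPartialAut s).dom.right_eq
  rw [← SetLike.mem_coe, h]
  exact subset_closure (Submodule.subset_span ⟨x, x.2, y, y.2, rfl⟩)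

/-- The assignment `x ⊗ ξ ↦ φ_s(x) ⊗ V_s ξ` preserves inner products, because
`⟨φ_s(x), φ_s(y)⟩ = β_s(⟨x, y⟩)` and `V_s` intertwines `π` with `π ∘ β_s`. -/
lemma inner_tensor_φ (s : S) (x y : M.sub s⁻¹) (ξ η : H) :
    inner ℂ (M.bimod.tensor ρ.π (M.φ s x) (ρ.V s ξ)) (M.bimod.tensor ρ.π (M.φ s y) (ρ.V s η)) =
      inner ℂ (M.bimod.tensor ρ.π (x : X) ξ) (M.bimod.tensor ρ.π (y : X) η) := by
  have hxy := M.rinner_mem x y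
  have hmem : ρ.π (M.bimod.rinner x y) η ∈ initialSpace (ρ.V s) := by
    rw [ρ.initialSpace_eq]
    exact apply_mem_essSpace hxy η
  rw [HilbertBimodule.inner_tensor, HilbertBimodule.inner_tensor,
    ← (M.isPartialAut s).map_rinner x y hxy, ρ.rep_act_apply,
    ← ContinuousLinearMap.adjoint_inner_right, ← ContinuousLinearMap.star_eq_adjoint,
    (ρ.isPartialIsometry s).star_apply_apply_of_mem_initialSpace hmem]

lemma tensor_apply_star {s : S} {y : X} (hy : y ∈ M.sub s) (ξ : H) :
    M.bimod.tensor ρ.π y (ρ.V s (star (ρ.V s) ξ)) = M.bimod.tensor ρ.π y ξ := by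
  obtain ⟨b, hb, z, rfl⟩ := (M.mem_sub_right s y).1 hy
  rw [HilbertBimodule.tensor_ract, HilbertBimodule.tensor_ract, ρ.rep_apply_apply_star hb]

lemma exists_inducedIsometry (s : S) :
    ∃ T : M.bimod.Induced ρ.π →L[ℂ] M.bimod.Induced ρ.π, IsPartialIsometry T ∧
      initialSpace T = M.bimod.subInduced ρ.π (M.sub s⁻¹) ∧
      finalSpace T = M.bimod.subInduced ρ.π (M.sub s) ∧
      ∀ (x : M.sub s⁻¹) (ξ : H), T (M.bimod.tensor ρ.π x ξ) =
        M.bimod.tensor ρ.π (M.φ s x) (ρ.V s ξ) := by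
  obtain ⟨T, hT, hi, hf, hTv⟩ := exists_isPartialIsometry_of_inner_eq
    (fun p : M.sub s⁻¹ × H => M.bimod.tensor ρ.π (p.1 : X) p.2)
    (fun p : M.sub s⁻¹ × H => M.bimod.tensor ρ.π (M.φ s p.1 : X) (ρ.V s p.2))
    (fun p q => M.inner_tensor_φ ρ s p.1 q.1 p.2 q.2)
  refine ⟨T, hT, ?_, ?_, fun x ξ => hTv (x, ξ)⟩
  · rw [hi, HilbertBimodule.subInduced]
    congr 2
    ext ζ
    constructor
    · rintro ⟨⟨x, ξ⟩, rfl⟩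
      exact ⟨x, x.2, ξ, rfl⟩
    · rintro ⟨x, hx, ξ, rfl⟩
      exact ⟨(⟨x, hx⟩, ξ), rfl⟩
  · rw [hf, HilbertBimodule.subInduced]
    congr 2
    ext ζ
    constructor
    · rintro ⟨⟨x, ξ⟩, rfl⟩
      exact ⟨_, (M.φ s x).2, _, rfl⟩
    · rintro ⟨y, hy, ξ, rfl⟩
      obtain ⟨x, hx⟩ := (M.isPartialAut s).surjective ⟨y, hy⟩
      refine ⟨(x, star (ρ.V s) ξ), ?_⟩
      dsimp only
      rw [hx, M.tensor_apply_star ρ hy]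

/-- The partial isometry `V^X_s` of `X ⊗_B H` with `V^X_s (x ⊗ ξ) = φ_s(x) ⊗ V_s ξ`. -/
noncomputable def inducedIsometry (s : S) : M.bimod.Induced ρ.π →L[ℂ] M.bimod.Induced ρ.π :=
  (M.exists_inducedIsometry ρ s).choose

lemma isPartialIsometry_inducedIsometry (s : S) : IsPartialIsometry (M.inducedIsometry ρ s) :=
  (M.exists_inducedIsometry ρ s).choose_spec.1

lemma initialSpace_inducedIsometry (s : S) :
    initialSpace (M.inducedIsometry ρ s) = M.bimod.subInduced ρ.π (M.sub s⁻¹) :=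
  (M.exists_inducedIsometry ρ s).choose_spec.2.1

lemma finalSpace_inducedIsometry (s : S) :
    finalSpace (M.inducedIsometry ρ s) = M.bimod.subInduced ρ.π (M.sub s) :=
  (M.exists_inducedIsometry ρ s).choose_spec.2.2.1

lemma inducedIsometry_tensor (s : S) (x : M.sub s⁻¹) (ξ : H) :
    M.inducedIsometry ρ s (M.bimod.tensor ρ.π x ξ) =
      M.bimod.tensor ρ.π (M.φ s x) (ρ.V s ξ) :=
  (M.exists_inducedIsometry ρ s).choose_spec.2.2.2 x ξ

lemma inducedIsometry_eq_zero {s : S} {ζ : M.bimod.Induced ρ.π}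
    (hζ : ζ ∈ (M.bimod.subInduced ρ.π (M.sub s⁻¹))ᗮ) : M.inducedIsometry ρ s ζ = 0 :=
  apply_eq_zero_of_mem_orthogonal_initialSpace (M.initialSpace_inducedIsometry ρ s ▸ hζ)

/-- An operator on `X ⊗_B H` is determined by its values on the elementary tensors of
`X_s ⊗_B H` and on the orthogonal complement of that subspace. -/
lemma ext_sub {s : S} {T T' : M.bimod.Induced ρ.π →L[ℂ] M.bimod.Induced ρ.π}
    (h : ∀ x ∈ M.sub s, ∀ ξ, T (M.bimod.tensor ρ.π x ξ) = T' (M.bimod.tensor ρ.π x ξ))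
    (h' : ∀ ζ ∈ (M.bimod.subInduced ρ.π (M.sub s))ᗮ, T ζ = T' ζ) : T = T' := by
  refine ContinuousLinearMap.ext_of_eqOn_of_eqOn_orthogonal ?_ h'
  rintro _ ⟨x, hx, ξ, rfl⟩
  exact h x hx ξ

/-- The intertwining relation `π^X(α_s(a)) V^X_s = V^X_s π^X(a)` for `a ∈ A_{s*}`. -/
lemma inducedRep_act_apply (s : S) (a : α.ideal s⁻¹) (ζ : M.bimod.Induced ρ.π) :
    M.bimod.inducedRep ρ.π (α.act s a : A) (M.inducedIsometry ρ s ζ) =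
      M.inducedIsometry ρ s (M.bimod.inducedRep ρ.π (a : A) ζ) := by
  refine DFunLike.congr_fun (M.ext_sub ρ (s := s⁻¹)
    (T := M.bimod.inducedRep ρ.π (α.act s a : A) ∘L M.inducedIsometry ρ s)
    (T' := M.inducedIsometry ρ s ∘L M.bimod.inducedRep ρ.π (a : A)) (fun x hx ξ => ?_)
    fun ζ hζ => ?_) ζ
  · have hax := (M.isPartialAut s).dom.lact_mem a x hx
    change M.bimod.inducedRep ρ.π (α.act s a : A)
        (M.inducedIsometry ρ s (M.bimod.tensor ρ.π x ξ)) =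
      M.inducedIsometry ρ s (M.bimod.inducedRep ρ.π (a : A) (M.bimod.tensor ρ.π x ξ))
    rw [HilbertBimodule.inducedRep_tensor, M.inducedIsometry_tensor ρ s ⟨x, hx⟩,
      M.inducedIsometry_tensor ρ s ⟨_, hax⟩, HilbertBimodule.inducedRep_tensor,
      (M.isPartialAut s).map_lact a ⟨x, hx⟩ hax]
  · change M.bimod.inducedRep ρ.π (α.act s a : A) (M.inducedIsometry ρ s ζ) =
      M.inducedIsometry ρ s (M.bimod.inducedRep ρ.π (a : A) ζ)
    rw [M.inducedIsometry_eq_zero ρ hζ, map_zero]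
    rw [← M.essSpace_inducedRep, mem_orthogonal_essSpace_iff] at hζ
    rw [hζ a a.2, map_zero]

lemma inducedRep_act (s : S) (a : α.ideal s⁻¹) :
    M.bimod.inducedRep ρ.π (α.act s a : A) =
      M.inducedIsometry ρ s * M.bimod.inducedRep ρ.π (a : A) * star (M.inducedIsometry ρ s) := by
  ext ζ
  have h := (M.isPartialIsometry_inducedIsometry ρ s).sub_apply_star_apply_mem ζ
  rw [M.finalSpace_inducedIsometry, ← M.essSpace_inducedRep, mem_orthogonal_essSpace_iff] at h
  have h' := h _ (α.act s a).2
  rw [map_sub, sub_eq_zero] at h'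
  rw [h']
  exact M.inducedRep_act_apply ρ s a _

/-- `V^X_r V^X_s` vanishes on the orthogonal complement of `X_{(rs)*} ⊗_B H`: for `a ∈ A_{r*}`
and `b ∈ A_s` the product `b a ∈ A_s ∩ A_{r*}` is `α_s(c)` with `c ∈ A_{(rs)*}`, and
`π^X(b a) V^X_s ζ = V^X_s π^X(c) ζ = 0` when `ζ` is orthogonal to that subspace. -/
lemma inducedIsometry_inducedIsometry_eq_zero {r s : S} {ζ : M.bimod.Induced ρ.π}
    (hζ : ζ ∈ (M.bimod.subInduced ρ.π (M.sub (r * s)⁻¹))ᗮ) :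
    M.inducedIsometry ρ r (M.inducedIsometry ρ s ζ) = 0 := by
  apply M.inducedIsometry_eq_zero
  rw [← M.essSpace_inducedRep, mem_orthogonal_essSpace_iff] at hζ ⊢
  intro a ha
  have hmem : M.inducedIsometry ρ s ζ ∈ essSpace (M.bimod.inducedRep ρ.π) (α.ideal s) := by
    rw [M.essSpace_inducedRep, ← M.finalSpace_inducedIsometry]
    exact ⟨ζ, rfl⟩
  refine eq_zero_of_mem_essSpace (rep_apply_mem_essSpace a hmem) fun b hb => ?_
  have hba : b * a ∈ α.ideal s := (α.ideal s).mul_mem_right' a hb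
  have hba' : b * a ∈ α.ideal r⁻¹ := (α.ideal r⁻¹).mul_mem_left' b ha
  obtain ⟨c, hc⟩ := (α.act s).surjective ⟨b * a, hba⟩
  have hc'' : (α.act s c : A) = b * a := congrArg Subtype.val hc
  have hc' : (c : A) ∈ α.ideal (r * s)⁻¹ := by
    refine (α.act_act_domain r s c).1 ⟨c.2, ?_⟩
    rw [partialApply_of_mem _ c.2, Subtype.coe_eta, hc'']
    exact hba'
  rw [← rep_mul_apply, ← hc'', M.inducedRep_act_apply, hζ c hc', map_zero]

lemma inducedIsometry_mul (r s : S) :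
    ∃ T, IsMultiplierImage (M.bimod.inducedRep ρ.π)
        (α.twist r s : DoubleCentralizer ℂ (α.ideal (r * s))) T ∧
      M.inducedIsometry ρ r * M.inducedIsometry ρ s = T * M.inducedIsometry ρ (r * s) := by
  obtain ⟨T, hT⟩ := exists_isMultiplierImage (M.bimod.inducedRep ρ.π) (α.twist r s).2
  obtain ⟨T', hT', hVV⟩ := ρ.mul_eq r s
  refine ⟨T, hT, M.ext_sub ρ (s := (r * s)⁻¹) (fun x hx ξ => ?_) fun ζ hζ => ?_⟩
  · change M.inducedIsometry ρ r (M.inducedIsometry ρ s (M.bimod.tensor ρ.π x ξ)) =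
      T (M.inducedIsometry ρ (r * s) (M.bimod.tensor ρ.π x ξ))
    -- With `y = φ_{rs}(x)`, the claim is `(u y v*) ⊗ π(v) V_{rs} ξ = π^X(u) (y ⊗ V_{rs} ξ)`.
    obtain ⟨h1, h2⟩ := (M.φ_φ_domain r s x).2 hx
    have h3 := M.φ_φ r s x hx
    rw [partialApply_of_mem _ h1] at h2 h3
    rw [partialApply_of_mem _ h2, partialApply_of_mem _ hx] at h3
    have hV : ρ.V r (ρ.V s ξ) = T' (ρ.V (r * s) ξ) := DFunLike.congr_fun hVV ξ
    rw [M.inducedIsometry_tensor ρ s ⟨x, h1⟩, M.inducedIsometry_tensor ρ r ⟨_, h2⟩,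
      M.inducedIsometry_tensor ρ (r * s) ⟨x, hx⟩, h3, hV]
    obtain ⟨a, ha, y, hy⟩ := (M.mem_sub_left (r * s) _).1 (M.φ (r * s) ⟨x, hx⟩).2
    rw [hy, ← HilbertBimodule.tensor_lmult_lact hT ha]
    have hmem : M.bimod.lmult (α.twist r s : DoubleCentralizer ℂ (α.ideal (r * s)))
        (M.bimod.lact a y) ∈ M.sub (r * s) := by
      rw [M.bimod.lmult_lact _ ⟨a, ha⟩]
      exact (M.mem_sub_left _ _).2 ⟨_, Subtype.property _, y, rfl⟩
    obtain ⟨b, hb, z, hz⟩ := (M.mem_sub_right (r * s) _).1 hmem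
    rw [hz, HilbertBimodule.tensor_rmult_star_ract (β.twist r s).2 hT' hb]
  · change M.inducedIsometry ρ r (M.inducedIsometry ρ s ζ) = T (M.inducedIsometry ρ (r * s) ζ)
    rw [M.inducedIsometry_inducedIsometry_eq_zero ρ hζ, M.inducedIsometry_eq_zero ρ hζ, map_zero]

/-- The covariant representation `(π^X, V^X, X ⊗_B H)` induced from `(π, V, H)`. -/
noncomputable def inducedCovariantRep : CovariantRep α (M.bimod.Induced ρ.π) where
  π := M.bimod.inducedRep ρ.π
  V := M.inducedIsometry ρ
  nondegenerate :=
    HilbertBimodule.isNondegenerateRep_inducedRep M.imprimitivity ρ.nondegenerate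
  isPartialIsometry := M.isPartialIsometry_inducedIsometry ρ
  initialSpace_eq s := by rw [M.initialSpace_inducedIsometry, M.essSpace_inducedRep]
  finalSpace_eq s := by rw [M.finalSpace_inducedIsometry, M.essSpace_inducedRep]
  mul_eq := M.inducedIsometry_mul ρ
  covariant := M.inducedRep_act ρ

end TwistedMoritaEquivalence

theorem mainTheorem7 {S A B X H : Type*} [InverseMonoid S]
    [NonUnitalCStarAlgebra A] [PartialOrder A] [StarOrderedRing A]
    [NonUnitalCStarAlgebra B] [PartialOrder B] [StarOrderedRing B]
    [AddCommGroup X] [Module ℂ X]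
    [NormedAddCommGroup H] [InnerProductSpace ℂ H] [CompleteSpace H]
    (α : BusbySmithAction S A) (β : BusbySmithAction S B) (M : TwistedMoritaEquivalence X α β)
    (ρ : CovariantRep β H) :
    ∃! σ : CovariantRep α (M.bimod.Induced ρ.π),
      (∀ (a : A) (x : X) (ξ : H),
        σ.π a (M.bimod.tensor ρ.π x ξ) = M.bimod.tensor ρ.π (M.bimod.lact a x) ξ) ∧
      (∀ (s : S) (x : M.sub s⁻¹) (ξ : H),
        σ.V s (M.bimod.tensor ρ.π x ξ) = M.bimod.tensor ρ.π (M.φ s x) (ρ.V s ξ)) ∧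
      (∀ s : S, ∀ ζ ∈ (M.bimod.subInduced ρ.π (M.sub s⁻¹))ᗮ, σ.V s ζ = 0) := by
  refine ⟨M.inducedCovariantRep ρ, ⟨HilbertBimodule.inducedRep_tensor,
    M.inducedIsometry_tensor ρ, fun s ζ hζ => M.inducedIsometry_eq_zero ρ hζ⟩, ?_⟩
  rintro τ ⟨h1, h2, h3⟩
  have hπ : τ.π = M.bimod.inducedRep ρ.π := by
    ext1 a
    refine HilbertBimodule.ext_tensor fun x ξ => ?_
    rw [h1, HilbertBimodule.inducedRep_tensor]
  have hV : τ.V = M.inducedIsometry ρ := by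
    funext s
    refine M.ext_sub ρ (s := s⁻¹) (fun x hx ξ => ?_) fun ζ hζ => ?_
    · rw [h2 s ⟨x, hx⟩, M.inducedIsometry_tensor ρ s ⟨x, hx⟩]
    · rw [h3 s ζ hζ, M.inducedIsometry_eq_zero ρ hζ]
  cases τ
  subst hπ hV
  rfl
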